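/- Let $A$ (the system) and $B$ (its environment) be finite-dimensional quantum systems with state spaces $\mathbb C^{d_A}$, $\mathbb C^{d_B}$, and let $\rho=\rho_{AB}$ be a density matrix on $\mathbb C^{d_A}\otimes\mathbb C^{d_B}$, with $\rho_A=\mathrm{tr}_B\rho$ and $\rho_B=\mathrm{tr}_A\rho$. Let $S(\sigma)=-\mathrm{tr}(\sigma\log_2\sigma)$ be the von Neumann entropy (with $0\log 0=0$). For a complete set $\{\Pi_i\}$ of mutually orthogonal rank-one projectors on $\mathbb C^{d_A}$ put $\Pi_i^A=\Pi_i\otimes 1$, $p_i=\mathrm{tr}(\Pi_i^A\rho)$, $\rho_{B|\Pi_i}=\frac1{p_i}\Pi_i^A\rho\,\Pi_i^A$, and $$\mathcal I_{B:A}=S(\rho_B)+S(\rho_A)-S(\rho),\qquad \mathcal J_{B:A}=S(\rho_B)-\sum_i p_i\,S(\rho_{B|\Pi_i})$$ (terms with $p_i=0$ are zero). The quantum discord with measurements on $A$ is $\mathcal D_{B:A}(\rho)=\min_{\{\Pi_i\}}(\mathcal I_{B:A}-\mathcal J_{B:A})$; this minimum is attained. (a) The following are equivalent: (i) $\mathcal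 D_{B:A}(\rho)=0$; (ii) $\rho=\sum_i\Pi_i^A\rho\,\Pi_i^A$ for some complete set $\{\Pi_i\}$ of mutually orthogonal rank-one projectors on $A$; (iii) $\rho=\sum_j p_j\,\Pi_j\otimes\tau_j$ for some such set $\{\Pi_j\}$, a probability vector $(p_j)$ and density matrices $\tau_j$ on $B$; (iv) $\rho=\sum_j p_j\,\Pi_j\otimes\tau_j$ for some finite family of mutually orthogonal projectors $\Pi_j$ on $A$ (of any ranks) with $\sum_j\Pi_j=1$, numbers $p_j\ge 0$ and density matrices $\tau_j$ on $B$. (b) Suppose $\mathcal D_{B:A}(\rho)=0$, and let $\rho=\sum_j p_j\,\Pi_j\otimes\tau_j$ be any decomposition as in (iv) (in particular, any as in (iii)). Let $U$ be any unitary on the joint system and $\{|n\rangle\}$ any orthonormal basis of the space of $B$, write $|v\rangle^B=1\otimes|v\rangle$ and $\langle v|^B=(|v\rangle^B)^\dagger$, and define operators on $A$ by $$K_{nm}=\sum_l\langle n|^B\,U\,(\sqrt{\tau_l}\,|m\rangle)^B\,\Pi_l .$$ Then $\sum_{n,m}K_{nm}^\dagger K_{nm}=1$, the map $\mathcal E(X)=\sum_{n,m}K_{nm}XK_{nm}^\dagger$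 is completely positive and trace preserving, and the reduced evolution of $A$ is given by it: $$\mathrm{tr}_B(U\rho\,U^\dagger)=\mathcal E(\mathrm{tr}_B\rho).$$ Moreover the same map $\mathcal E$, which does not depend on the $p_j$, describes the reduced evolution of every state $\sigma=\sum_j q_j\,\Pi_j\otimes\tau_j$ with the same $\Pi_j$ and $\tau_j$: $\mathrm{tr}_B(U\sigma U^\dagger)=\mathcal E(\mathrm{tr}_B\sigma)$. -/

import Mathlib

/-!
Finite-dimensional quantum systems. A system whose state space is `ℂ^A` is given by a finite index
type `A` of its computational basis; the composite of `A` and `B` is indexed by `A × B`, and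
tensor products of operators are Kronecker products.
-/

open scoped Matrix Kronecker MatrixOrder ComplexOrder

namespace QDiscord

noncomputable section

variable {A B ι κ : Type*} [Fintype A] [DecidableEq A] [Fintype B] [DecidableEq B]
  [Fintype ι] [Fintype κ]

/-- Density matrices: positive semidefinite of trace one. -/
structure IsState (ρ : Matrix A A ℂ) : Prop where
  posSemidef : ρ.PosSemidef
  trace_eq_one : ρ.trace = 1

/-- The partial trace over the second system: `(tr_B ρ)_{mn} = ∑ i, ρ_{mi,ni}`. -/
def trB (ρ : Matrix (A × B) (A × B) ℂ) : Matrix A A ℂ :=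
  Matrix.of fun m n => ∑ i : B, ρ (m, i) (n, i)

/-- The partial trace over the first system. -/
def trA (ρ : Matrix (A × B) (A × B) ℂ) : Matrix B B ℂ :=
  Matrix.of fun m n => ∑ i : A, ρ (i, m) (i, n)

/-- The von Neumann entropy `-∑ λ log₂ λ` over the eigenvalues of a Hermitian matrix, with
multiplicity and with `0 log 0 = 0`. (The value on non-Hermitian matrices is irrelevant.) -/
def entropy (ρ : Matrix A A ℂ) : ℝ :=
  open Classical in
  if h : ρ.IsHermitian then ∑ i, -(h.eigenvalues i * Real.logb 2 (h.eigenvalues i)) else 0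

/-- A complete set of mutually orthogonal (self-adjoint) projectors, of arbitrary ranks. -/
structure IsProjFamily (P : ι → Matrix A A ℂ) : Prop where
  isHermitian : ∀ i, (P i).IsHermitian
  mul_self : ∀ i, P i * P i = P i
  orthogonal : ∀ i j, i ≠ j → P i * P j = 0
  complete : ∑ i, P i = 1

/-- A complete set of one-dimensional orthogonal projectors. Such a set has exactly as many
members as the dimension of the system, and is therefore indexed by `A` itself. -/
structure IsMeasurement (P : A → Matrix A A ℂ) : Prop extends IsProjFamily P where
  rank_eq_one : ∀ i, (P i).rank = 1

/-- The operator `M ⊗ 1` on the joint system. -/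
def onA (B : Type*) [DecidableEq B] (M : Matrix A A ℂ) : Matrix (A × B) (A × B) ℂ :=
  M ⊗ₖ (1 : Matrix B B ℂ)

/-- The probability `tr (Π^A ρ)` of the outcome `Π`. -/
def outcomeProb (ρ : Matrix (A × B) (A × B) ℂ) (M : Matrix A A ℂ) : ℝ :=
  (onA B M * ρ).trace.re

/-- The state `(1 / p) Π^A ρ Π^A` of the joint system after the outcome `Π`. (For an outcome of
probability zero it is the zero matrix; it is only ever used with the weight `p`.) -/
def postState (ρ : Matrix (A × B) (A × B) ℂ) (M : Matrix A A ℂ) : Matrix (A × B) (A × B) ℂ :=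
  ((outcomeProb ρ M : ℂ))⁻¹ • (onA B M * ρ * onA B M)

/-- The conditional entropy `∑ i, p_i S(ρ_{B|Π_i})` for measurements on `A`. -/
def condEntropy (ρ : Matrix (A × B) (A × B) ℂ) (P : A → Matrix A A ℂ) : ℝ :=
  ∑ i, outcomeProb ρ (P i) * entropy (postState ρ (P i))

/-- The quantum mutual information `I_{B:A} = S(ρ_B) + S(ρ_A) - S(ρ_AB)`. -/
def mutualI (ρ : Matrix (A × B) (A × B) ℂ) : ℝ :=
  entropy (trA ρ) + entropy (trB ρ) - entropy ρ

/-- The information `J_{B:A} = S(ρ_B) - S(ρ_AB | {Π_i^A})` about `B` from measuring `A`. -/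
def mutualJ (ρ : Matrix (A × B) (A × B) ℂ) (P : A → Matrix A A ℂ) : ℝ :=
  entropy (trA ρ) - condEntropy ρ P

/-- All values of `I_{B:A} - J_{B:A}`, as the measurement on `A` varies. -/
def discordValues (ρ : Matrix (A × B) (A × B) ℂ) : Set ℝ :=
  {d | ∃ P : A → Matrix A A ℂ, IsMeasurement P ∧ d = mutualI ρ - mutualJ ρ P}

/-- The quantum discord `D_{B:A}(ρ) = min (I_{B:A} - J_{B:A})`, over the measurements on `A`. -/
def discordBA (ρ : Matrix (A × B) (A × B) ℂ) : ℝ :=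
  sInf (discordValues ρ)

/-- The matrix `∑ j, p_j Π_j ⊗ τ_j`. -/
def cqMatrix (p : ι → ℝ) (P : ι → Matrix A A ℂ) (τ : ι → Matrix B B ℂ) :
    Matrix (A × B) (A × B) ℂ :=
  ∑ j, (p j : ℂ) • (P j ⊗ₖ τ j)

/-- `|v⟩^B = 1 ⊗ |v⟩`, as an operator from `A` to the joint system. -/
def ketB (A : Type*) [DecidableEq A] (v : B → ℂ) : Matrix (A × B) A ℂ :=
  Matrix.of fun x a => if x.1 = a then v x.2 else 0

/-- `⟨v|^B`, the adjoint of `|v⟩^B`. -/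
def braB (A : Type*) [DecidableEq A] (v : B → ℂ) : Matrix A (A × B) ℂ :=
  (ketB A v)ᴴ

/-- `K_{nm} = ∑ l, ⟨n|^B U (√τ_l |m⟩)^B Π_l`, for an orthonormal basis `e` of the space of `B`. -/
def krausOp (P : ι → Matrix A A ℂ) (τ : ι → Matrix B B ℂ) (U : Matrix (A × B) (A × B) ℂ)
    (e : OrthonormalBasis B ℂ (EuclideanSpace ℂ B)) (nm : B × B) : Matrix A A ℂ :=
  ∑ l, braB A (e nm.1) * U * ketB A (CFC.sqrt (τ l) *ᵥ (e nm.2)) * P l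

/-- The linear map `X ↦ ∑ k, K_k X K_k†`. -/
def krausMap (K : κ → Matrix A A ℂ) : Matrix A A ℂ →ₗ[ℂ] Matrix A A ℂ where
  toFun X := ∑ k, K k * X * (K k)ᴴ
  map_add' X Y := by simp [Matrix.mul_add, Matrix.add_mul, Finset.sum_add_distrib]
  map_smul' c X := by simp [Finset.smul_sum]

/-- The map `I ⊗ E` on the system `A` together with an auxiliary system `C`: `E` is applied to
each of the blocks of `X`. -/
def ampliation (C : Type*) (E : Matrix A A ℂ →ₗ[ℂ] Matrix A A ℂ) (X : Matrix (C × A) (C × A) ℂ) :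
    Matrix (C × A) (C × A) ℂ :=
  Matrix.of fun x y => E (Matrix.of fun a a' => X (x.1, a) (y.1, a')) x.2 y.2

/-- Completely positive trace-preserving maps: `E` preserves the trace, and `I ⊗ E` is positive
for auxiliary systems of every dimension. -/
structure IsCPTP (E : Matrix A A ℂ →ₗ[ℂ] Matrix A A ℂ) : Prop where
  trace_preserving : ∀ X, (E X).trace = X.trace
  positive : ∀ X : Matrix A A ℂ, X.PosSemidef → (E X).PosSemidef
  completely_positive : ∀ (k : ℕ) (X : Matrix (Fin k × A) (Fin k × A) ℂ),
    X.PosSemidef → (ampliation (Fin k) E X).PosSemidef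

/-- The state of `A` after the joint system in the state `ρ` has evolved under `U`. -/
def reducedEvolution (U ρ : Matrix (A × B) (A × B) ℂ) : Matrix A A ℂ :=
  trB (U * ρ * Uᴴ)

end

end QDiscord

/-! For a measurement `P`, write `R = ρ_A ⊗ 1` and `T = ∑ postState ρ (P i) = ∑ P i ⊗ τ_i`. Up to
the factor `log 2`, the difference `I - J` is `tr ρ log ρ - tr ρ log R - tr ρ log T`, the relative
entropy of `ρ` with respect to `exp (log R + log T)`, and `tr (R T) = tr ρ`. Klein's inequality
bounds it below by `tr ρ - tr exp (log R + log T)`, which Golden–Thompson makes nonnegative.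

The equality case needs remainders. Golden–Thompson is used with the defect `‖[√R, √T]‖² / 2`
(`re_trace_exp_add_le`, `re_trace_sq_sub`) and Klein with the defect `‖√ρ - exp ((log R + log T) /
2)‖²` (`two_mul_trace_le`), both in Hilbert–Schmidt norm. Singular `R` and `T` are reached through
`regLog δ` as `δ → 0` (`relativeEntropy_regLog`). Zero discord thus gives commuting `R`, `T` with `ρ
= R T`. A measurement that diagonalizes simultaneously `ρ_A` and a matrix `∑ f i • P i`, where `f`
separates the distinct `τ_i`, then makes `ρ` block diagonal (`IsProjFamily.exists_measurement`).

Conversely, for a block diagonal state the entropies add over the blocks and `I - J` vanishes for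
that measurement. The minimum is attained because measurements are parametrized by the compact
unitary group and `I - J` is continuous there.

For the evolution, the operators `W_m = ∑ l, (√τ_l |m⟩)^B Π_l` satisfy `∑ W_m Π_j W_m† = Π_j ⊗ τ_j`.
The joint state is therefore recovered linearly from its marginal on `A`, with no reference to the
weights; applying `U` and tracing out `B` yields the Kraus operators. -/

namespace QDiscord

set_option linter.unusedSectionVars false

open Filter Topology

/-! ### The Lie–Trotter product formula. -/

section Trotter

variable {𝔸 : Type*} [NormedRing 𝔸] [NormOneClass 𝔸]

/-- Telescoping, one factor exchanged at a time. -/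
lemma norm_pow_sub_pow_le {x y : 𝔸} {c : ℝ} (hx : ‖x‖ ≤ c) (hy : ‖y‖ ≤ c) (hc : 1 ≤ c) (n : ℕ) :
    ‖x ^ n - y ^ n‖ ≤ n * c ^ n * ‖x - y‖ := by
  induction n with
  | zero => simp
  | succ n ih =>
    have h : x ^ (n + 1) - y ^ (n + 1) = x ^ n * (x - y) + (x ^ n - y ^ n) * y := by
      noncomm_ring
    have hxn : ‖x ^ n‖ ≤ c ^ (n + 1) := by
      calc ‖x ^ n‖ ≤ ‖x‖ ^ n := norm_pow_le _ _
        _ ≤ c ^ n := by gcongr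
        _ ≤ c ^ (n + 1) := pow_le_pow_right₀ hc (Nat.le_succ n)
    calc ‖x ^ (n + 1) - y ^ (n + 1)‖ ≤ ‖x ^ n‖ * ‖x - y‖ + ‖x ^ n - y ^ n‖ * ‖y‖ := by
          rw [h]
          exact (norm_add_le _ _).trans (add_le_add (norm_mul_le _ _) (norm_mul_le _ _))
      _ ≤ c ^ (n + 1) * ‖x - y‖ + n * c ^ n * ‖x - y‖ * c := by gcongr
      _ = ((n + 1 : ℕ) : ℝ) * c ^ (n + 1) * ‖x - y‖ := by push_cast; ring

variable [NormedAlgebra ℝ 𝔸]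

lemma norm_exp_le_exp_norm (x : 𝔸) : ‖NormedSpace.exp x‖ ≤ Real.exp ‖x‖ := by
  rw [NormedSpace.exp_eq_tsum ℝ, Real.exp_eq_exp_ℝ, NormedSpace.exp_eq_tsum ℝ]
  refine tsum_of_norm_bounded (NormedSpace.expSeries_summable' (𝕂 := ℝ) ‖x‖).hasSum fun n => ?_
  rw [norm_smul, Real.norm_of_nonneg (by positivity), smul_eq_mul]
  gcongr
  exact norm_pow_le x n

variable [CompleteSpace 𝔸]

/-- The Lie–Trotter product formula. -/
lemma tendsto_trotter (x y : 𝔸) :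
    Tendsto (fun n : ℕ => (NormedSpace.exp ((n : ℝ)⁻¹ • x) * NormedSpace.exp ((n : ℝ)⁻¹ • y)) ^ n)
      atTop (𝓝 (NormedSpace.exp (x + y))) := by
  let f : ℝ → 𝔸 := fun t =>
    NormedSpace.exp (t • x) * NormedSpace.exp (t • y) - NormedSpace.exp (t • (x + y))
  have hf0 : f 0 = 0 := by simp [f]
  -- Both terms of `f` have derivative `x + y` at `0`, so `n * ‖f (1/n)‖ → 0`, exactly the rate that
  -- telescoping over `n` factors requires.
  have hf : HasDerivAt f 0 0 := by
    have h := ((hasDerivAt_exp_smul_const x (0 : ℝ)).mul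
      (hasDerivAt_exp_smul_const y (0 : ℝ))).sub (hasDerivAt_exp_smul_const (x + y) (0 : ℝ))
    exact h.congr_deriv (by simp)
  have hlim : Tendsto (fun n : ℕ => (n : ℝ) * ‖f ((n : ℝ)⁻¹)‖) atTop (𝓝 0) := by
    have h1 := hf.tendsto_slope_zero
    have h2 : Tendsto (fun n : ℕ => (n : ℝ)⁻¹) atTop (𝓝[≠] 0) := by
      refine tendsto_nhdsWithin_iff.2 ⟨tendsto_inv_atTop_nhds_zero_nat, ?_⟩
      filter_upwards [eventually_gt_atTop 0] with n hn
      simpa using hn.ne'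
    have h3 := (h1.comp h2).norm
    simpa [Function.comp_def, hf0, norm_smul] using h3
  rw [tendsto_iff_norm_sub_tendsto_zero]
  have hbound := hlim.const_mul (Real.exp (‖x‖ + ‖y‖))
  rw [mul_zero] at hbound
  refine squeeze_zero' (Eventually.of_forall fun _ => norm_nonneg _) ?_ hbound
  filter_upwards [eventually_gt_atTop 0] with n hn
  have hn' : (0 : ℝ) < n := by exact_mod_cast hn
  set c := Real.exp ((n : ℝ)⁻¹ * (‖x‖ + ‖y‖)) with hc
  have h1 : NormedSpace.exp (x + y) = NormedSpace.exp ((n : ℝ)⁻¹ • (x + y)) ^ n := by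
    let := NormedAlgebra.restrictScalars ℚ ℝ 𝔸
    rw [← NormedSpace.exp_nsmul, ← Nat.cast_smul_eq_nsmul ℝ, smul_smul,
      mul_inv_cancel₀ hn'.ne', one_smul]
  have hns : ∀ z : 𝔸, ‖(n : ℝ)⁻¹ • z‖ = (n : ℝ)⁻¹ * ‖z‖ := fun z => by
    rw [norm_smul, Real.norm_of_nonneg (by positivity)]
  have h2 : ‖NormedSpace.exp ((n : ℝ)⁻¹ • x) * NormedSpace.exp ((n : ℝ)⁻¹ • y)‖ ≤ c := by
    rw [hc, mul_add, Real.exp_add, ← hns, ← hns]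
    exact (norm_mul_le _ _).trans (mul_le_mul (norm_exp_le_exp_norm _) (norm_exp_le_exp_norm _)
      (norm_nonneg _) (Real.exp_nonneg _))
  have h3 : ‖NormedSpace.exp ((n : ℝ)⁻¹ • (x + y))‖ ≤ c := by
    refine (norm_exp_le_exp_norm _).trans ?_
    rw [hc, hns]
    gcongr
    exact norm_add_le _ _
  have h4 : 1 ≤ c := Real.one_le_exp (by positivity)
  have h5 : c ^ n = Real.exp (‖x‖ + ‖y‖) := by
    rw [hc, ← Real.exp_nat_mul]
    congr 1
    field_simp
  rw [h1]
  refine (norm_pow_sub_pow_le h2 h3 h4 n).trans (le_of_eq ?_)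
  rw [h5]
  ring

end Trotter

/-! ### Trace inequalities and Golden–Thompson with a remainder. -/

section TraceInequalities

variable {n : Type*} [Fintype n]

lemma re_trace_mul_conjTranspose (X : Matrix n n ℂ) :
    (X * Xᴴ).trace.re = ∑ i, ∑ j, ‖X i j‖ ^ 2 := by
  simp [Matrix.trace, Matrix.mul_apply, Complex.mul_conj, Complex.normSq_eq_norm_sq,
    -Complex.ofReal_pow]

lemma re_trace_mul_conjTranspose_nonneg (X : Matrix n n ℂ) : 0 ≤ (X * Xᴴ).trace.re := by
  rw [re_trace_mul_conjTranspose]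
  positivity

lemma eq_zero_of_re_trace_mul_conjTranspose {X : Matrix n n ℂ} (h : (X * Xᴴ).trace.re = 0) :
    X = 0 := by
  rw [re_trace_mul_conjTranspose, Finset.sum_eq_zero_iff_of_nonneg (fun _ _ => by positivity)] at h
  ext i j
  have h1 := h i (Finset.mem_univ i)
  rw [Finset.sum_eq_zero_iff_of_nonneg (fun _ _ => by positivity)] at h1
  simpa using h1 j (Finset.mem_univ j)

lemma norm_trace_mul_le (X Y : Matrix n n ℂ) :
    ‖(X * Y).trace‖ ≤ ((X * Xᴴ).trace.re + (Yᴴ * Y).trace.re) / 2 := by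
  have h : (Yᴴ * Y).trace.re = ∑ i, ∑ j, ‖Y j i‖ ^ 2 := by
    have := re_trace_mul_conjTranspose Yᴴ
    simpa using this
  rw [re_trace_mul_conjTranspose, h, ← Finset.sum_add_distrib, Finset.sum_div]
  refine (norm_sum_le _ _).trans (Finset.sum_le_sum fun i _ => ?_)
  rw [← Finset.sum_add_distrib, Finset.sum_div]
  refine (norm_sum_le _ _).trans (Finset.sum_le_sum fun j _ => ?_)
  rw [norm_mul]
  nlinarith [sq_nonneg (‖X i j‖ - ‖Y j i‖)]

/-- Expanding the squared commutator gives four traces that agree in pairs by cyclicity. This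
identity is the source of the commutator defect. -/
lemma re_trace_sq_sub {M N : Matrix n n ℂ} (hM : M.IsHermitian) (hN : N.IsHermitian) :
    (M * N * (M * N)).trace.re = (M * M * (N * N)).trace.re -
      ((M * N - N * M) * (M * N - N * M)ᴴ).trace.re / 2 := by
  have h : (M * N - N * M) * (M * N - N * M)ᴴ =
      M * N * N * M - M * N * (M * N) - N * M * (N * M) + N * M * M * N := by
    rw [Matrix.conjTranspose_sub, Matrix.conjTranspose_mul, Matrix.conjTranspose_mul, hM.eq, hN.eq]
    noncomm_ring
  have h1 : (M * N * N * M).trace = (M * M * (N * N)).trace := by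
    rw [Matrix.trace_mul_comm]; simp only [mul_assoc]
  have h2 : (N * M * M * N).trace = (M * M * (N * N)).trace := by
    rw [mul_assoc, mul_assoc, Matrix.trace_mul_comm]; simp only [mul_assoc]
  have h3 : (N * M * (N * M)).trace = (M * N * (M * N)).trace := by
    rw [mul_assoc, Matrix.trace_mul_comm]; simp only [mul_assoc]
  rw [h, Matrix.trace_add, Matrix.trace_sub, Matrix.trace_sub, h1, h2, h3]
  simp only [Complex.add_re, Complex.sub_re]
  ring

variable [DecidableEq n]

lemma trace_mul_pow_comm (X Y : Matrix n n ℂ) (k : ℕ) :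
    ((X * Y) ^ k).trace = ((Y * X) ^ k).trace := by
  cases k with
  | zero => simp
  | succ k =>
    have h : (Y * X) ^ (k + 1) = Y * (X * Y) ^ k * X := by
      have : SemiconjBy X (Y * X) (X * Y) := by simp [SemiconjBy, mul_assoc]
      have h2 := this.pow_right k
      rw [pow_succ', mul_assoc Y, h2.eq, mul_assoc]
    rw [h, Matrix.trace_mul_comm, ← mul_assoc, ← pow_succ']

/-- Both inequalities are proved together by induction on the exponent. -/
lemma norm_trace_pow_two_pow_le_aux (k : ℕ) :
    (∀ X : Matrix n n ℂ, ‖(X ^ 2 ^ (k + 1)).trace‖ ≤ ((X * Xᴴ) ^ 2 ^ k).trace.re) ∧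
    ∀ P Q : Matrix n n ℂ, P.IsHermitian → Q.IsHermitian →
      ‖((P * Q) ^ 2 ^ k).trace‖ ≤ ((P ^ 2 ^ (k + 1)).trace.re + (Q ^ 2 ^ (k + 1)).trace.re) / 2 := by
  induction k with
  | zero =>
    refine ⟨fun X => ?_, fun P Q hP hQ => ?_⟩
    · have h := norm_trace_mul_le X X
      rw [Matrix.trace_mul_comm Xᴴ X, add_self_div_two] at h
      simpa [pow_two] using h
    · have h := norm_trace_mul_le P Q
      rw [hP.eq, hQ.eq] at h
      simpa [pow_two] using h
  | succ k ih =>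
    obtain ⟨ihC, ihE⟩ := ih
    refine ⟨fun X => ?_, fun P Q hP hQ => ?_⟩
    -- By cyclicity `X² (X²)ᴴ` may be replaced by the product of the Hermitian matrices `X Xᴴ` and
    -- `Xᴴ X`, to which the second inequality applies.
    · have h1 := ihC (X ^ 2)
      rw [← pow_mul, ← pow_succ'] at h1
      refine h1.trans ?_
      have h2 : X ^ 2 * (X ^ 2)ᴴ = X * (X * Xᴴ * Xᴴ) := by
        simp only [pow_two, Matrix.conjTranspose_mul, mul_assoc]
      have h3 : X * Xᴴ * Xᴴ * X = (X * Xᴴ) * (Xᴴ * X) := by simp only [mul_assoc]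
      rw [h2, trace_mul_pow_comm, h3]
      have h4 := ihE (X * Xᴴ) (Xᴴ * X) (Matrix.isHermitian_mul_conjTranspose_self X)
        (Matrix.isHermitian_conjTranspose_mul_self X)
      rw [trace_mul_pow_comm Xᴴ X, add_self_div_two] at h4
      exact (Complex.re_le_norm _).trans h4
    · refine (ihC (P * Q)).trans ?_
      have h1 : P * Q * (P * Q)ᴴ = P * (Q * Q * P) := by
        rw [Matrix.conjTranspose_mul, hP.eq, hQ.eq]; simp only [mul_assoc]
      have h2 : Q * Q * P * P = Q ^ 2 * P ^ 2 := by simp only [pow_two, mul_assoc]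
      rw [h1, trace_mul_pow_comm, h2, trace_mul_pow_comm]
      have h3 := ihE (P ^ 2) (Q ^ 2) (hP.pow 2) (hQ.pow 2)
      rw [← pow_mul, ← pow_mul, ← pow_succ'] at h3
      exact (Complex.re_le_norm _).trans h3

/-- One step of monotonicity along the dyadic Trotter sequence, with `P = exp (H / 2^(k+1))` and `Q
= exp (K / 2^(k+1))`. -/
lemma re_trace_mul_pow_le {P Q : Matrix n n ℂ} (hP : P.IsHermitian) (hQ : Q.IsHermitian) (k : ℕ) :
    ((P * Q) ^ 2 ^ (k + 1)).trace.re ≤ ((P ^ 2 * Q ^ 2) ^ 2 ^ k).trace.re := by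
  have h := (Complex.re_le_norm _).trans ((norm_trace_pow_two_pow_le_aux k).1 (P * Q))
  have h1 : P * Q * (P * Q)ᴴ = P * (Q * Q * P) := by
    rw [Matrix.conjTranspose_mul, hP.eq, hQ.eq]; simp only [mul_assoc]
  have h2 : Q * Q * P * P = Q ^ 2 * P ^ 2 := by simp only [pow_two, mul_assoc]
  rwa [h1, trace_mul_pow_comm P (Q * Q * P), h2, trace_mul_pow_comm (Q ^ 2)] at h

open scoped Matrix.Norms.L2Operator in
lemma tendsto_trotter_matrix (H K : Matrix n n ℂ) :
    Tendsto (fun m : ℕ => (NormedSpace.exp ((m : ℝ)⁻¹ • H) * NormedSpace.exp ((m : ℝ)⁻¹ • K)) ^ m)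
      atTop (𝓝 (NormedSpace.exp (H + K))) := by
  cases isEmpty_or_nonempty n
  · exact (tendsto_const_nhds (x := NormedSpace.exp (H + K))).congr fun _ => Subsingleton.elim _ _
  · exact tendsto_trotter H K

/-- A sharpened form of the Golden–Thompson inequality. -/
lemma re_trace_exp_add_le {H K : Matrix n n ℂ} (hH : H.IsHermitian) (hK : K.IsHermitian) :
    (NormedSpace.exp (H + K)).trace.re ≤
      ((NormedSpace.exp ((2 : ℝ)⁻¹ • H) * NormedSpace.exp ((2 : ℝ)⁻¹ • K)) ^ 2).trace.re := by
  let a : ℕ → ℝ := fun k => ((NormedSpace.exp (((2 ^ k : ℕ) : ℝ)⁻¹ • H) *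
    NormedSpace.exp (((2 ^ k : ℕ) : ℝ)⁻¹ • K)) ^ 2 ^ k).trace.re
  have hsq : ∀ (k : ℕ) (M : Matrix n n ℂ), NormedSpace.exp (((2 ^ (k + 1) : ℕ) : ℝ)⁻¹ • M) ^ 2 =
      NormedSpace.exp (((2 ^ k : ℕ) : ℝ)⁻¹ • M) := by
    intro k M
    rw [← Matrix.exp_nsmul, ← Nat.cast_smul_eq_nsmul ℝ, smul_smul]
    congr 2
    push_cast
    rw [pow_succ]
    field_simp
  have hherm : ∀ (r : ℝ) {M : Matrix n n ℂ}, M.IsHermitian →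
      (NormedSpace.exp (r • M)).IsHermitian := by
    intro r M hM
    refine Matrix.IsHermitian.exp ?_
    rw [Matrix.IsHermitian, Matrix.conjTranspose_smul, hM.eq, star_trivial]
  have ha : Antitone a := by
    refine antitone_nat_of_succ_le fun k => ?_
    have h := re_trace_mul_pow_le (hherm (((2 ^ (k + 1) : ℕ) : ℝ)⁻¹) hH)
      (hherm (((2 ^ (k + 1) : ℕ) : ℝ)⁻¹) hK) k
    rwa [hsq, hsq] at h
  have hcont : Continuous fun M : Matrix n n ℂ => M.trace.re := by fun_prop
  have hlim : Tendsto a atTop (𝓝 (NormedSpace.exp (H + K)).trace.re) :=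
    ((hcont.tendsto _).comp (tendsto_trotter_matrix H K)).comp
      (tendsto_pow_atTop_atTop_of_one_lt one_lt_two)
  -- Index `0` would give the usual bound `tr (exp H * exp K)`. Stopping at index `1` keeps the
  -- square whose trace falls short of that bound by the commutator term.
  have h := ha.le_of_tendsto hlim 1
  simpa [a] using h

end TraceInequalities

/-! ### Functional calculus of Hermitian matrices. -/

section FunctionalCalculus

variable {n : Type*} [Fintype n] [DecidableEq n]

lemma cfc_eq_conj_diagonal {M : Matrix n n ℂ} (hM : M.IsHermitian) (f : ℝ → ℝ) :
    cfc f M = (hM.eigenvectorUnitary : Matrix n n ℂ) *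
      Matrix.diagonal (fun i => (f (hM.eigenvalues i) : ℂ)) *
      (hM.eigenvectorUnitary : Matrix n n ℂ)ᴴ := by
  rw [hM.cfc_eq, Matrix.IsHermitian.cfc, Unitary.conjStarAlgAut_apply]
  rfl

lemma isHermitian_cfc (f : ℝ → ℝ) (M : Matrix n n ℂ) : (cfc f M).IsHermitian :=
  cfc_predicate f M

lemma continuousOn_spectrum (f : ℝ → ℝ) (M : Matrix n n ℂ) : ContinuousOn f (spectrum ℝ M) :=
  (Matrix.finite_real_spectrum (A := M)).continuousOn f

lemma trace_cfc {M : Matrix n n ℂ} (hM : M.IsHermitian) (f : ℝ → ℝ) :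
    (cfc f M).trace = ∑ i, (f (hM.eigenvalues i) : ℂ) := by
  have h : (hM.eigenvectorUnitary : Matrix n n ℂ)ᴴ * (hM.eigenvectorUnitary : Matrix n n ℂ) = 1 :=
    Unitary.coe_star_mul_self hM.eigenvectorUnitary
  rw [cfc_eq_conj_diagonal hM, Matrix.trace_mul_comm, ← mul_assoc, h, one_mul,
    Matrix.trace_diagonal]

/-- The overlaps `w i j` are the squared moduli of the inner products of the eigenvectors. -/
lemma exists_trace_cfc_mul_cfc {M N : Matrix n n ℂ} (hM : M.IsHermitian) (hN : N.IsHermitian) :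
    ∃ w : n → n → ℝ, (∀ i j, 0 ≤ w i j) ∧ ∀ f g : ℝ → ℝ,
      (cfc f M * cfc g N).trace.re =
        ∑ i, ∑ j, w i j * (f (hM.eigenvalues i) * g (hN.eigenvalues j)) := by
  set U := (hM.eigenvectorUnitary : Matrix n n ℂ) with hU
  set V := (hN.eigenvectorUnitary : Matrix n n ℂ) with hV
  refine ⟨fun i j => ‖(Uᴴ * V) i j‖ ^ 2, fun _ _ => by positivity, fun f g => ?_⟩
  rw [cfc_eq_conj_diagonal hM, cfc_eq_conj_diagonal hN, ← hU, ← hV]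
  have h : (U * Matrix.diagonal (fun i => (f (hM.eigenvalues i) : ℂ)) * Uᴴ *
      (V * Matrix.diagonal (fun i => (g (hN.eigenvalues i) : ℂ)) * Vᴴ)).trace =
      (Matrix.diagonal (fun i => (f (hM.eigenvalues i) : ℂ)) * (Uᴴ * V) *
      (Matrix.diagonal (fun i => (g (hN.eigenvalues i) : ℂ)) * (Uᴴ * V)ᴴ)).trace := by
    rw [Matrix.conjTranspose_mul, Matrix.conjTranspose_conjTranspose, mul_assoc, mul_assoc,
      Matrix.trace_mul_comm]
    simp only [mul_assoc]
  rw [h, Matrix.trace, Complex.re_sum]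
  refine Finset.sum_congr rfl fun i _ => ?_
  rw [Matrix.diag_apply, Matrix.mul_apply, Complex.re_sum]
  refine Finset.sum_congr rfl fun j _ => ?_
  rw [Matrix.diagonal_mul, Matrix.diagonal_mul, Matrix.conjTranspose_apply]
  set z := (Uᴴ * V) i j
  have hz : (f (hM.eigenvalues i) : ℂ) * z * (g (hN.eigenvalues j) * star z) =
      ((‖z‖ ^ 2 * (f (hM.eigenvalues i) * g (hN.eigenvalues j)) : ℝ) : ℂ) := by
    have := Complex.mul_conj z
    rw [Complex.normSq_eq_norm_sq] at this
    rw [Complex.star_def]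
    push_cast at this ⊢
    linear_combination ((f (hM.eigenvalues i) : ℂ) * g (hN.eigenvalues j)) * this
  rw [hz, Complex.ofReal_re]

lemma exp_smul_cfc {M : Matrix n n ℂ} (hM : M.IsHermitian) (f : ℝ → ℝ) (r : ℝ) :
    NormedSpace.exp (r • cfc f M) = cfc (fun x => Real.exp (r * f x)) M := by
  have hunit : IsUnit (hM.eigenvectorUnitary : Matrix n n ℂ) :=
    (Unitary.toUnits hM.eigenvectorUnitary).isUnit
  have hinv : (hM.eigenvectorUnitary : Matrix n n ℂ)ᴴ = (hM.eigenvectorUnitary : Matrix n n ℂ)⁻¹ :=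
    (Matrix.inv_eq_left_inv (Unitary.coe_star_mul_self hM.eigenvectorUnitary)).symm
  rw [cfc_eq_conj_diagonal hM, cfc_eq_conj_diagonal hM, hinv, ← smul_mul_assoc, ← mul_smul_comm,
    Matrix.exp_conj _ _ hunit, ← Matrix.diagonal_smul, Matrix.exp_diagonal]
  congr 3
  ext i
  rw [Pi.coe_exp]
  simp [Complex.exp_eq_exp_ℂ]

lemma exp_smul_eq_cfc {M : Matrix n n ℂ} (hM : M.IsHermitian) (r : ℝ) :
    NormedSpace.exp (r • M) = cfc (fun x => Real.exp (r * x)) M := by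
  have h := exp_smul_cfc hM id r
  rwa [cfc_id ℝ M hM.isSelfAdjoint] at h

lemma cfc_mul_apply (f g : ℝ → ℝ) (M : Matrix n n ℂ) :
    cfc f M * cfc g M = cfc (fun x => f x * g x) M :=
  (cfc_mul f g M (continuousOn_spectrum f M) (continuousOn_spectrum g M)).symm

lemma cfc_sqrt_mul_self {M : Matrix n n ℂ} (hM : M.PosSemidef) :
    cfc Real.sqrt M * cfc Real.sqrt M = M := by
  rw [cfc_mul_apply]
  conv_rhs => rw [← cfc_id ℝ M hM.isHermitian.isSelfAdjoint]
  refine cfc_congr fun x hx => ?_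
  rw [hM.isHermitian.spectrum_real_eq_range_eigenvalues] at hx
  obtain ⟨i, rfl⟩ := hx
  exact Real.mul_self_sqrt (hM.eigenvalues_nonneg i)

lemma exists_polynomial_eval_eq (s : Finset ℝ) (f : ℝ → ℝ) :
    ∃ q : Polynomial ℝ, ∀ x ∈ s, q.eval x = f x :=
  ⟨Lagrange.interpolate s id f, fun _ hx =>
    Lagrange.eval_interpolate_at_node f (Set.injOn_id _) hx⟩

/-- On finitely many Hermitian matrices the functional calculus is given by one polynomial. -/
lemma exists_aeval_eq_cfc {m ι : Type*} [Fintype m] [DecidableEq m] [Fintype ι] (f : ℝ → ℝ)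
    {M : Matrix n n ℂ} (hM : M.IsHermitian) {N : ι → Matrix m m ℂ} (hN : ∀ i, (N i).IsHermitian) :
    ∃ q : Polynomial ℝ, q.eval 0 = f 0 ∧ Polynomial.aeval M q = cfc f M ∧
      ∀ i, Polynomial.aeval (N i) q = cfc f (N i) := by
  classical
  -- The extra node `0` fixes the constant coefficient of `q`, needed when powers of orthogonal sums
  -- are split.
  obtain ⟨q, hq⟩ := exists_polynomial_eval_eq ({0} ∪ (Finset.univ.image hM.eigenvalues) ∪
    Finset.univ.biUnion fun i => Finset.univ.image (hN i).eigenvalues) f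
  have key : ∀ {k : Type _} [Fintype k] [DecidableEq k] {L : Matrix k k ℂ} (hL : L.IsHermitian),
      (∀ i, q.eval (hL.eigenvalues i) = f (hL.eigenvalues i)) →
      Polynomial.aeval L q = cfc f L := by
    intro k _ _ L hL h
    rw [← cfc_polynomial q L hL.isSelfAdjoint]
    refine cfc_congr fun x hx => ?_
    rw [hL.spectrum_real_eq_range_eigenvalues] at hx
    obtain ⟨i, rfl⟩ := hx
    exact h i
  refine ⟨q, hq 0 (by simp), ?_, fun i => ?_⟩
  · rw [← cfc_polynomial q M hM.isSelfAdjoint]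
    refine cfc_congr fun x hx => ?_
    rw [hM.spectrum_real_eq_range_eigenvalues] at hx
    obtain ⟨i, rfl⟩ := hx
    exact hq _ (by simp)
  · refine key (hN i) fun j => hq _ ?_
    simp only [Finset.mem_union, Finset.mem_biUnion, Finset.mem_image, Finset.mem_univ, true_and]
    exact Or.inr ⟨i, j, rfl⟩

end FunctionalCalculus

/-! ### Relative entropy with respect to `exp (log R + log T)` and its vanishing. -/

section RelativeEntropy

variable {n : Type*} [Fintype n]

lemma re_trace_sub_mul_sub {M N : Matrix n n ℂ} (hM : M.IsHermitian) (hN : N.IsHermitian) :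
    ((M - N) * (M - N)ᴴ).trace.re =
      (M * M).trace.re - 2 * (M * N).trace.re + (N * N).trace.re := by
  rw [Matrix.conjTranspose_sub, hM.eq, hN.eq, sub_mul, mul_sub, mul_sub, Matrix.trace_sub,
    Matrix.trace_sub, Matrix.trace_sub, Matrix.trace_mul_comm N M]
  simp only [Complex.sub_re]
  ring

variable [DecidableEq n]

/-- This is `log y ≤ y - 1` at `y = exp (x/2) / √r`, multiplied by `2 r`. The square roots make the
remainder in Klein's inequality a squared Hilbert–Schmidt distance. -/
lemma two_mul_le_mul_log_sub {r : ℝ} (hr : 0 ≤ r) (x : ℝ) :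
    0 ≤ r * Real.log r - r * x - 2 * r + 2 * (√r * Real.exp (2⁻¹ * x)) := by
  rcases hr.eq_or_lt with rfl | hr
  · simp
  have hs : 0 < √r := Real.sqrt_pos.2 hr
  have h := Real.log_le_sub_one_of_pos (div_pos (Real.exp_pos (2⁻¹ * x)) hs)
  rw [Real.log_div (Real.exp_pos _).ne' hs.ne', Real.log_exp, Real.log_sqrt hr.le] at h
  have h2 : r * (Real.exp (2⁻¹ * x) / √r) = √r * Real.exp (2⁻¹ * x) := by
    nth_rewrite 1 [← Real.mul_self_sqrt hr.le]
    field_simp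
  nlinarith [mul_le_mul_of_nonneg_left h hr.le]

/-- A form of Klein's inequality. -/
lemma two_mul_trace_le {ρ X : Matrix n n ℂ} (hρ : ρ.PosSemidef) (hX : X.IsHermitian) :
    2 * ρ.trace.re ≤ (cfc (fun x => x * Real.log x) ρ).trace.re - (ρ * X).trace.re +
      2 * (cfc Real.sqrt ρ * NormedSpace.exp ((2 : ℝ)⁻¹ • X)).trace.re := by
  obtain ⟨w, hw, h⟩ := exists_trace_cfc_mul_cfc hρ.isHermitian hX
  have h1 := h id (fun _ => 1)
  have h2 := h (fun x => x * Real.log x) (fun _ => 1)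
  have h3 := h id id
  have h4 := h Real.sqrt (fun x => Real.exp (2⁻¹ * x))
  rw [cfc_const_one ℝ X hX.isSelfAdjoint, mul_one] at h1 h2
  rw [cfc_id ℝ ρ hρ.isHermitian.isSelfAdjoint] at h1 h3
  rw [cfc_id ℝ X hX.isSelfAdjoint] at h3
  rw [exp_smul_eq_cfc hX, h1, h2, h3, h4, ← sub_nonneg]
  simp only [Finset.mul_sum, ← Finset.sum_add_distrib, ← Finset.sum_sub_distrib]
  refine Finset.sum_nonneg fun i _ => Finset.sum_nonneg fun j _ => ?_
  have := mul_nonneg (hw i j)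
    (two_mul_le_mul_log_sub (hρ.eigenvalues_nonneg i) (hX.eigenvalues j))
  simp only [id]
  linarith

/-- Lower bound for the relative entropy of `ρ` with respect to `exp (H + K)`. -/
lemma relativeEntropy_exp_add_ge {ρ H K : Matrix n n ℂ} (hρ : ρ.PosSemidef)
    (hH : H.IsHermitian) (hK : K.IsHermitian) {M N : Matrix n n ℂ}
    (hM : NormedSpace.exp ((2 : ℝ)⁻¹ • H) = M) (hN : NormedSpace.exp ((2 : ℝ)⁻¹ • K) = N) :
    ρ.trace.re - (M * M * (N * N)).trace.re + ((M * N - N * M) * (M * N - N * M)ᴴ).trace.re / 2 +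
      ((cfc Real.sqrt ρ - NormedSpace.exp ((2 : ℝ)⁻¹ • (H + K))) *
        (cfc Real.sqrt ρ - NormedSpace.exp ((2 : ℝ)⁻¹ • (H + K)))ᴴ).trace.re ≤
    (cfc (fun x => x * Real.log x) ρ).trace.re - (ρ * H).trace.re - (ρ * K).trace.re := by
  have hherm : ∀ {L : Matrix n n ℂ}, L.IsHermitian →
      (NormedSpace.exp ((2 : ℝ)⁻¹ • L)).IsHermitian := by
    intro L hL
    rw [exp_smul_eq_cfc hL]
    exact isHermitian_cfc _ _
  have hE : NormedSpace.exp ((2 : ℝ)⁻¹ • (H + K)) * NormedSpace.exp ((2 : ℝ)⁻¹ • (H + K)) =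
      NormedSpace.exp (H + K) := by
    rw [← Matrix.exp_add_of_commute _ _ (Commute.refl _), ← add_smul]
    norm_num
  -- With `X = H + K`, Klein's bound `2 tr ρ - 2 tr (√ρ exp (X/2))` is `tr ρ - tr exp X` plus the
  -- squared distance of `√ρ` from `exp (X/2)`; `h1` then bounds `tr exp X`.
  have h1 := re_trace_exp_add_le hH hK
  rw [hM, hN, pow_two, re_trace_sq_sub (hM ▸ hherm hH) (hN ▸ hherm hK)] at h1
  have h2 := two_mul_trace_le hρ (hH.add hK)
  rw [re_trace_sub_mul_sub (isHermitian_cfc _ _) (hherm (hH.add hK)), cfc_sqrt_mul_self hρ, hE]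
  rw [mul_add, Matrix.trace_add, Complex.add_re] at h2
  linarith

/-- The logarithm with the singularity at `0` replaced by `log (δ ^ 2)`. -/
noncomputable def regLog (δ x : ℝ) : ℝ := if x = 0 then 2 * Real.log δ else Real.log x

/-- The second summand is `δ` times the kernel projector. The right side is continuous at `δ = 0`,
where the logarithm itself blows up. -/
lemma exp_half_cfc_regLog {M : Matrix n n ℂ} (hM : M.PosSemidef) {δ : ℝ} (hδ : 0 < δ) :
    NormedSpace.exp ((2 : ℝ)⁻¹ • cfc (regLog δ) M) =
      cfc Real.sqrt M + δ • cfc (fun x : ℝ => (if x = 0 then 1 else 0 : ℝ)) M := by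
  rw [exp_smul_cfc hM.isHermitian, ← cfc_const_mul δ _ M (continuousOn_spectrum _ _),
    ← cfc_add _ _ _ (continuousOn_spectrum _ _) (continuousOn_spectrum _ _)]
  refine cfc_congr fun x hx => ?_
  rw [hM.isHermitian.spectrum_real_eq_range_eigenvalues] at hx
  obtain ⟨i, rfl⟩ := hx
  by_cases h : hM.isHermitian.eigenvalues i = 0
  · simp [regLog, h, Real.exp_log hδ]
  · have h0 : 0 < hM.isHermitian.eigenvalues i :=
      lt_of_le_of_ne (hM.eigenvalues_nonneg i) (Ne.symm h)
    simp only [regLog, h, if_false, mul_zero, add_zero]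
    rw [mul_comm, Real.exp_mul, Real.exp_log h0, Real.sqrt_eq_rpow]
    norm_num

/-- If `a` and `b` are the values of `tr (ρ log R)` and `tr (ρ log T)`, then the relative entropy
of `ρ` with respect to `exp (log R + log T)` is nonnegative as soon as `tr (R T) = tr ρ`, and
it vanishes only if `R` and `T` commute and have product `ρ`. -/
lemma relativeEntropy_regLog {ρ R T : Matrix n n ℂ} (hρ : ρ.PosSemidef) (hR : R.PosSemidef)
    (hT : T.PosSemidef) (htr : (R * T).trace.re = ρ.trace.re) {a b : ℝ}
    (ha : ∀ δ, (ρ * cfc (regLog δ) R).trace.re = a)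
    (hb : ∀ δ, (ρ * cfc (regLog δ) T).trace.re = b) :
    0 ≤ (cfc (fun x => x * Real.log x) ρ).trace.re - a - b ∧
    ((cfc (fun x => x * Real.log x) ρ).trace.re - a - b = 0 → Commute R T ∧ ρ = R * T) := by
  set D := (cfc (fun x => x * Real.log x) ρ).trace.re - a - b with hD
  set z : ℝ → ℝ := fun x => if x = 0 then 1 else 0
  let M : ℝ → Matrix n n ℂ := fun δ => cfc Real.sqrt R + δ • cfc z R
  let N : ℝ → Matrix n n ℂ := fun δ => cfc Real.sqrt T + δ • cfc z T
  have hM : Continuous M := by fun_prop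
  have hN : Continuous N := by fun_prop
  have hM0 : M 0 = cfc Real.sqrt R := by simp [M]
  have hN0 : N 0 = cfc Real.sqrt T := by simp [N]
  have hMM : M 0 * M 0 = R := by rw [hM0, cfc_sqrt_mul_self hR]
  have hNN : N 0 * N 0 = T := by rw [hN0, cfc_sqrt_mul_self hT]
  have hlow : ∀ δ, 0 < δ → ρ.trace.re - (M δ * M δ * (N δ * N δ)).trace.re +
      ((M δ * N δ - N δ * M δ) * (M δ * N δ - N δ * M δ)ᴴ).trace.re / 2 +
      ((cfc Real.sqrt ρ - NormedSpace.exp ((2 : ℝ)⁻¹ • (cfc (regLog δ) R + cfc (regLog δ) T))) *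
        (cfc Real.sqrt ρ -
          NormedSpace.exp ((2 : ℝ)⁻¹ • (cfc (regLog δ) R + cfc (regLog δ) T)))ᴴ).trace.re ≤ D := by
    intro δ hδ
    have h := relativeEntropy_exp_add_ge hρ (isHermitian_cfc (regLog δ) R)
      (isHermitian_cfc (regLog δ) T) (exp_half_cfc_regLog hR hδ) (exp_half_cfc_regLog hT hδ)
    rwa [ha, hb] at h
  have hlim : ∀ {F : ℝ → ℝ}, Continuous F → (∀ δ, 0 < δ → F δ ≤ D) → F 0 ≤ D := by
    intro F hF h
    refine le_of_tendsto ((hF.tendsto 0).mono_left (nhdsWithin_le_nhds (s := Set.Ioi 0))) ?_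
    filter_upwards [self_mem_nhdsWithin] with δ hδ using h δ hδ
  -- Continuity at `δ = 0` of the exponential of the summed logarithms is not available yet, so its
  -- nonnegative term is dropped before the limit.
  have h1 : ((M 0 * N 0 - N 0 * M 0) * (M 0 * N 0 - N 0 * M 0)ᴴ).trace.re / 2 ≤ D := by
    have h := hlim (F := fun δ => ρ.trace.re - (M δ * M δ * (N δ * N δ)).trace.re +
      ((M δ * N δ - N δ * M δ) * (M δ * N δ - N δ * M δ)ᴴ).trace.re / 2) (by fun_prop)
      fun δ hδ => (le_add_of_nonneg_right (re_trace_mul_conjTranspose_nonneg _)).trans (hlow δ hδ)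
    simp only [hMM, hNN, htr, sub_self, zero_add] at h
    exact h
  have h2 := re_trace_mul_conjTranspose_nonneg (M 0 * N 0 - N 0 * M 0)
  refine ⟨by linarith, fun hD0 => ?_⟩
  have hcomm0 : Commute (M 0) (N 0) :=
    sub_eq_zero.1 (eq_zero_of_re_trace_mul_conjTranspose (by linarith))
  have hcomm : Commute R T := by
    rw [← hMM, ← hNN]
    exact (hcomm0.mul_left hcomm0).mul_right (hcomm0.mul_left hcomm0)
  refine ⟨hcomm, ?_⟩
  have hcfc : ∀ f g : ℝ → ℝ, Commute (cfc f R) (cfc g T) := fun f g =>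
    ((hcomm.cfc_real f).symm.cfc_real g).symm
  -- Once `R` and `T` commute, the exponential factors as `M δ * N δ`, and the term dropped above
  -- survives the limit.
  have h3 : ((cfc Real.sqrt ρ - M 0 * N 0) * (cfc Real.sqrt ρ - M 0 * N 0)ᴴ).trace.re ≤ D := by
    have h := hlim (F := fun δ => ρ.trace.re - (M δ * M δ * (N δ * N δ)).trace.re +
      ((cfc Real.sqrt ρ - M δ * N δ) * (cfc Real.sqrt ρ - M δ * N δ)ᴴ).trace.re) (by fun_prop)
      fun δ hδ => by
        have h := hlow δ hδ
        rw [smul_add, Matrix.exp_add_of_commute _ _ (((hcfc _ _).smul_left _).smul_right _),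
          exp_half_cfc_regLog hR hδ, exp_half_cfc_regLog hT hδ] at h
        have h' := re_trace_mul_conjTranspose_nonneg (M δ * N δ - N δ * M δ)
        linarith
    simp only [hMM, hNN, htr, sub_self, zero_add] at h
    exact h
  have h4 : cfc Real.sqrt ρ = M 0 * N 0 :=
    sub_eq_zero.1 (eq_zero_of_re_trace_mul_conjTranspose
      (le_antisymm (by linarith) (re_trace_mul_conjTranspose_nonneg _)))
  calc ρ = cfc Real.sqrt ρ * cfc Real.sqrt ρ := (cfc_sqrt_mul_self hρ).symm
    _ = M 0 * N 0 * (M 0 * N 0) := by rw [h4]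
    _ = M 0 * M 0 * (N 0 * N 0) := hcomm0.symm.mul_mul_mul_comm _ _
    _ = R * T := by rw [hMM, hNN]

end RelativeEntropy

/-! ### Measurements as orthonormal bases, compactness, simultaneous diagonalization. -/

section Measurements

variable {A : Type*} [Fintype A] [DecidableEq A]

/-- The measurement in the orthonormal basis formed by the columns of `V`. -/
noncomputable def basisMeasurement (V : Matrix A A ℂ) (i : A) : Matrix A A ℂ :=
  V * Matrix.diagonal (Pi.single i 1) * Vᴴ

lemma basisMeasurement_apply (V : Matrix A A ℂ) (i a b : A) :
    basisMeasurement V i a b = V a i * star (V b i) := by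
  rw [basisMeasurement, Matrix.mul_apply, Finset.sum_eq_single i]
  · simp [Matrix.mul_diagonal]
  · intro j _ hj
    simp [Matrix.mul_diagonal, hj]
  · simp

lemma conj_diagonal_mul_conj_diagonal {V : Matrix A A ℂ} (hV : V ∈ Matrix.unitaryGroup A ℂ)
    (c d : A → ℂ) :
    V * Matrix.diagonal c * Vᴴ * (V * Matrix.diagonal d * Vᴴ) =
      V * Matrix.diagonal (fun i => c i * d i) * Vᴴ := by
  have h : Vᴴ * V = 1 := Matrix.mem_unitaryGroup_iff'.1 hV
  calc V * Matrix.diagonal c * Vᴴ * (V * Matrix.diagonal d * Vᴴ)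
      = V * Matrix.diagonal c * (Vᴴ * V) * Matrix.diagonal d * Vᴴ := by simp only [mul_assoc]
    _ = V * (Matrix.diagonal c * Matrix.diagonal d) * Vᴴ := by rw [h, mul_one]; simp only [mul_assoc]
    _ = _ := by rw [Matrix.diagonal_mul_diagonal]

lemma isMeasurement_basisMeasurement {V : Matrix A A ℂ} (hV : V ∈ Matrix.unitaryGroup A ℂ) :
    IsMeasurement (basisMeasurement V) where
  isHermitian i := by
    ext a b
    simp [basisMeasurement_apply, mul_comm]
  mul_self i := by
    rw [basisMeasurement, conj_diagonal_mul_conj_diagonal hV]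
    congr 3
    ext j
    by_cases h : j = i <;> simp [h]
  orthogonal i j hij := by
    rw [basisMeasurement, basisMeasurement, conj_diagonal_mul_conj_diagonal hV]
    have : (fun k => (Pi.single i 1 : A → ℂ) k * (Pi.single j 1 : A → ℂ) k) = fun _ => 0 := by
      ext k
      by_cases h : k = i
      · subst h; simp [hij]
      · simp [h]
    rw [this]
    simp
  complete := by
    have h : V * Vᴴ = 1 := Matrix.mem_unitaryGroup_iff.1 hV
    ext a b
    rw [← h, Matrix.sum_apply, Matrix.mul_apply]
    simp [basisMeasurement_apply]
  rank_eq_one i := by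
    have hdet : IsUnit V.det := (Matrix.isUnit_iff_isUnit_det V).1
      (Unitary.toUnits (⟨V, hV⟩ : unitary (Matrix A A ℂ))).isUnit
    have hdet' : IsUnit Vᴴ.det := by
      rw [Matrix.det_conjTranspose]
      exact hdet.star
    rw [basisMeasurement, Matrix.rank_mul_eq_left_of_isUnit_det _ _ hdet',
      Matrix.rank_mul_eq_right_of_isUnit_det _ _ hdet, Matrix.rank_diagonal]
    rw [Fintype.card_eq_one_iff]
    refine ⟨⟨i, by simp⟩, fun ⟨j, hj⟩ => ?_⟩
    by_contra h
    exact hj (Pi.single_eq_of_ne (fun h' => h (Subtype.ext h')) _)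

lemma exists_vec_of_rank_one {P : Matrix A A ℂ} (hP : P.IsHermitian) (hmul : P * P = P)
    (hrank : P.rank = 1) : ∃ u : A → ℂ, ∀ a b, P a b = u a * star (u b) := by
  obtain ⟨v, -, hv⟩ := finrank_eq_one_iff'.1 hrank
  have hcol : ∀ b, ∃ c : ℂ, ∀ a, P a b = c * v.1 a := by
    intro b
    obtain ⟨c, hc⟩ := hv ⟨P.mulVecLin (Pi.single b 1), LinearMap.mem_range_self _ _⟩
    refine ⟨c, fun a => ?_⟩
    have h := congrFun (congrArg Subtype.val hc) a
    simpa using h.symm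
  choose c hc using hcol
  set s : ℝ := ∑ k, ‖v.1 k‖ ^ 2 with hs
  have hs0 : 0 ≤ s := by positivity
  -- Column `b` of `P` is `c b • v`, and `P = Pᴴ * P` gives `P a b = star (c a) * c b * ‖v‖²`; hence
  -- the factor `√s = ‖v‖`.
  refine ⟨fun a => (√s : ℂ) * star (c a), fun a b => ?_⟩
  have h1 : P a b = ∑ k, star (P k a) * P k b := by
    have h : P = Pᴴ * P := by rw [hP.eq, hmul]
    conv_lhs => rw [h]
    rfl
  have h2 : ∀ k, star (P k a) * P k b = star (c a) * c b * ((‖v.1 k‖ ^ 2 : ℝ) : ℂ) := by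
    intro k
    have h := Complex.mul_conj (v.1 k)
    rw [Complex.normSq_eq_norm_sq] at h
    rw [hc, hc, ← h, star_mul, Complex.star_def]
    ring
  have h3 : (√s : ℂ) * (√s : ℂ) = ((s : ℝ) : ℂ) := by
    rw [← Complex.ofReal_mul, Real.mul_self_sqrt hs0]
  rw [h1, Finset.sum_congr rfl fun k _ => h2 k, ← Finset.mul_sum, ← Complex.ofReal_sum, ← hs, ← h3]
  simp only [star_mul, Complex.star_def, Complex.conj_ofReal, Complex.conj_conj]
  ring

/-- Writing `P i = u_i u_i†`, completeness says that the square matrix with columns `u_i` satisfies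
`V V† = 1`. -/
lemma IsMeasurement.exists_unitary {P : A → Matrix A A ℂ} (hP : IsMeasurement P) :
    ∃ V ∈ Matrix.unitaryGroup A ℂ, P = basisMeasurement V := by
  choose u hu using fun i => exists_vec_of_rank_one (hP.isHermitian i) (hP.mul_self i)
    (hP.rank_eq_one i)
  refine ⟨Matrix.of fun a i => u i a, ?_, ?_⟩
  · rw [Matrix.mem_unitaryGroup_iff, ← hP.complete]
    ext a b
    simp [Matrix.sum_apply, Matrix.mul_apply, hu, Matrix.star_apply]
  · ext i a b
    simp [basisMeasurement_apply, hu]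

lemma IsMeasurement.trace_eq_one {P : A → Matrix A A ℂ} (hP : IsMeasurement P) (i : A) :
    (P i).trace = 1 := by
  obtain ⟨V, hV, rfl⟩ := hP.exists_unitary
  have h : Vᴴ * V = 1 := Matrix.mem_unitaryGroup_iff'.1 hV
  rw [basisMeasurement, Matrix.trace_mul_comm, ← mul_assoc, h, one_mul, Matrix.trace_diagonal]
  simp

lemma isCompact_unitaryGroup : IsCompact (Matrix.unitaryGroup A ℂ : Set (Matrix A A ℂ)) := by
  have hK : IsCompact (Set.univ.pi fun _ : A => Set.univ.pi fun _ : A => Metric.closedBall (0 : ℂ) 1) :=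
    isCompact_univ_pi fun _ => isCompact_univ_pi fun _ => isCompact_closedBall _ _
  refine hK.of_isClosed_subset ?_ ?_
  · have : (Matrix.unitaryGroup A ℂ : Set (Matrix A A ℂ)) = {V | V * Vᴴ = 1} := by
      ext V
      exact Matrix.mem_unitaryGroup_iff
    rw [this]
    exact isClosed_eq (by fun_prop) continuous_const
  · intro V hV a _ b _
    rw [mem_closedBall_zero_iff]
    exact entry_norm_bound_of_unitary hV a b

/-- The space is the orthogonal sum of the joint eigenspaces; an orthonormal basis adapted to them
diagonalizes both matrices. -/
lemma exists_measurement_commute {H N : Matrix A A ℂ} (hH : H.IsHermitian) (hN : N.IsHermitian)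
    (hcomm : Commute H N) :
    ∃ P : A → Matrix A A ℂ, IsMeasurement P ∧ ∀ i, Commute (P i) H ∧ Commute (P i) N := by
  have hHs : (Matrix.toEuclideanLin H).IsSymmetric := Matrix.isSymmetric_toEuclideanLin_iff.2 hH
  have hNs : (Matrix.toEuclideanLin N).IsSymmetric := Matrix.isSymmetric_toEuclideanLin_iff.2 hN
  have hc : Commute (Matrix.toEuclideanLin H) (Matrix.toEuclideanLin N) := by
    refine LinearMap.ext fun x => ?_
    have h : H *ᵥ (N *ᵥ x.ofLp) = N *ᵥ (H *ᵥ x.ofLp) := by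
      rw [Matrix.mulVec_mulVec, Matrix.mulVec_mulVec, hcomm.eq]
    simpa [Matrix.toEuclideanLin, Matrix.toLpLin_apply] using h
  classical
  have hinternal := LinearMap.IsSymmetric.directSum_isInternal_of_commute hHs hNs hc
  have horth := LinearMap.IsSymmetric.orthogonalFamily_eigenspace_inf_eigenspace hHs hNs
  -- The joint eigenspaces are indexed by all of `ℂ × ℂ`; a finite basis is extracted after
  -- discarding the zero ones.
  have hfin : Finite {i : ℂ × ℂ // Module.End.eigenspace (Matrix.toEuclideanLin H) i.2 ⊓
      Module.End.eigenspace (Matrix.toEuclideanLin N) i.1 ≠ ⊥} :=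
    WellFoundedGT.finite_ne_bot_of_iSupIndep hinternal.submodule_iSupIndep
  have := Fintype.ofFinite {i : ℂ × ℂ // Module.End.eigenspace (Matrix.toEuclideanLin H) i.2 ⊓
      Module.End.eigenspace (Matrix.toEuclideanLin N) i.1 ≠ ⊥}
  replace hinternal := DirectSum.isInternal_ne_bot_iff.2 hinternal
  replace horth := horth.comp (γ := {i : ℂ × ℂ // Module.End.eigenspace (Matrix.toEuclideanLin H) i.2 ⊓
      Module.End.eigenspace (Matrix.toEuclideanLin N) i.1 ≠ ⊥}) Subtype.val_injective
  let b := (hinternal.subordinateOrthonormalBasis (finrank_euclideanSpace (𝕜 := ℂ) (ι := A)) horth).reindex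
    (Fintype.equivFin A).symm
  have hb : ∀ i, ∃ l : ℂ × ℂ, Matrix.toEuclideanLin H (b i) = l.2 • b i ∧
      Matrix.toEuclideanLin N (b i) = l.1 • b i := by
    intro i
    have h := hinternal.subordinateOrthonormalBasis_subordinate
      (finrank_euclideanSpace (𝕜 := ℂ) (ι := A)) (Fintype.equivFin A i) horth
    refine ⟨(hinternal.subordinateOrthonormalBasisIndex (finrank_euclideanSpace (𝕜 := ℂ) (ι := A))
      (Fintype.equivFin A i) horth).1, Module.End.mem_eigenspace_iff.1 ?_,
      Module.End.mem_eigenspace_iff.1 ?_⟩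
    · simpa [b] using h.1
    · simpa [b] using h.2
  choose l hlH hlN using hb
  let V : Matrix A A ℂ := Matrix.of fun a i => b i a
  have hV : V ∈ Matrix.unitaryGroup A ℂ := by
    rw [Matrix.mem_unitaryGroup_iff']
    ext i j
    have h := orthonormal_iff_ite.1 b.orthonormal i j
    rw [Matrix.mul_apply, Matrix.one_apply, ← h, PiLp.inner_apply]
    refine Finset.sum_congr rfl fun k _ => ?_
    simp [V, Matrix.star_apply, mul_comm]
  have hdiag : ∀ {L : Matrix A A ℂ} (d : A → ℂ),
      (∀ i, Matrix.toEuclideanLin L (b i) = d i • b i) → L = V * Matrix.diagonal d * Vᴴ := by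
    intro L d hd
    have h1 : L * V = V * Matrix.diagonal d := by
      ext a i
      have h := congrArg (fun x : EuclideanSpace ℂ A => x a) (hd i)
      rw [Matrix.mul_diagonal, Matrix.mul_apply]
      simpa [V, Matrix.toEuclideanLin, Matrix.toLpLin_apply, Matrix.mulVec, dotProduct,
        mul_comm] using h
    have h2 : V * Vᴴ = 1 := Matrix.mem_unitaryGroup_iff.1 hV
    rw [← h1, mul_assoc, h2, mul_one]
  refine ⟨basisMeasurement V, isMeasurement_basisMeasurement hV, fun i => ?_⟩
  have hcomm' : ∀ d : A → ℂ, Commute (basisMeasurement V i) (V * Matrix.diagonal d * Vᴴ) := by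
    intro d
    rw [Commute, SemiconjBy, basisMeasurement, conj_diagonal_mul_conj_diagonal hV,
      conj_diagonal_mul_conj_diagonal hV]
    simp only [mul_comm]
  rw [hdiag _ hlH, hdiag _ hlN]
  exact ⟨hcomm' _, hcomm' _⟩

end Measurements

/-! ### Projector families and block diagonal matrices. -/

section ProjFamilies

variable {A B ι : Type*} [Fintype A] [DecidableEq A] [Fintype B] [DecidableEq B] [Fintype ι]

lemma onA_mul (M N : Matrix A A ℂ) : onA B (M * N) = onA B M * onA B N := by
  rw [onA, onA, onA, ← Matrix.mul_kronecker_mul, one_mul]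

lemma onA_one : onA B (1 : Matrix A A ℂ) = 1 := Matrix.one_kronecker_one

lemma onA_sum {κ : Type*} (s : Finset κ) (M : κ → Matrix A A ℂ) :
    onA B (∑ i ∈ s, M i) = ∑ i ∈ s, onA B (M i) := by
  ext x y
  simp [onA, Matrix.sum_apply, Finset.sum_mul]

lemma isHermitian_onA {M : Matrix A A ℂ} (hM : M.IsHermitian) : (onA B M).IsHermitian := by
  rw [Matrix.IsHermitian, onA, Matrix.conjTranspose_kronecker, hM.eq, Matrix.conjTranspose_one]

lemma IsProjFamily.onA {P : ι → Matrix A A ℂ} (hP : IsProjFamily P) :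
    IsProjFamily fun i => onA B (P i) where
  isHermitian i := isHermitian_onA (hP.isHermitian i)
  mul_self i := by rw [← onA_mul, hP.mul_self]
  orthogonal i j hij := by rw [← onA_mul, hP.orthogonal i j hij]; simp [QDiscord.onA]
  complete := by rw [← onA_sum, hP.complete, onA_one]

lemma IsProjFamily.sum_mul_sum {P : ι → Matrix A A ℂ} (hP : IsProjFamily P) (X : Matrix A A ℂ) :
    X = ∑ i, ∑ j, P i * X * P j := by
  simp only [← Finset.mul_sum, hP.complete, mul_one, ← Finset.sum_mul, one_mul]

/-- A matrix commuting with all members of a complete family of projectors is block diagonal. -/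
lemma IsProjFamily.eq_sum_of_commute {P : ι → Matrix A A ℂ} (hP : IsProjFamily P)
    {X : Matrix A A ℂ} (h : ∀ i, Commute (P i) X) : X = ∑ i, P i * X * P i := by
  have h1 : ∀ i, P i * X * P i = P i * X := fun i => by
    rw [mul_assoc, ← (h i).eq, ← mul_assoc, hP.mul_self]
  simp only [h1, ← Finset.sum_mul, hP.complete, one_mul]

lemma kronecker_eq_zero {M : Matrix A A ℂ} {N : Matrix B B ℂ} (h : M ⊗ₖ N = 0) :
    M = 0 ∨ N = 0 := by
  by_contra! hne
  obtain ⟨a, b, hab⟩ : ∃ a b, M a b ≠ 0 := by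
    by_contra! h'
    exact hne.1 (by ext a b; exact h' a b)
  obtain ⟨c, d, hcd⟩ : ∃ a b, N a b ≠ 0 := by
    by_contra! h'
    exact hne.2 (by ext a b; exact h' a b)
  have := congrFun (congrFun h (a, c)) (b, d)
  exact mul_ne_zero hab hcd this

/-- The blocks of `X` between projectors with different `τ` vanish iff `X ⊗ 1` commutes with
`∑ i, P i ⊗ τ i`. -/
lemma IsProjFamily.commute_onA_iff {P : ι → Matrix A A ℂ} (hP : IsProjFamily P)
    (X : Matrix A A ℂ) (τ : ι → Matrix B B ℂ) :
    Commute (QDiscord.onA B X) (∑ i, P i ⊗ₖ τ i) ↔ ∀ i j, τ i ≠ τ j → P i * X * P j = 0 := by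
  classical
  set T := ∑ i, P i ⊗ₖ τ i with hT
  have hPT : ∀ i, QDiscord.onA B (P i) * T = P i ⊗ₖ τ i := by
    intro i
    rw [hT, Finset.mul_sum, Finset.sum_eq_single i]
    · rw [QDiscord.onA, ← Matrix.mul_kronecker_mul, hP.mul_self, one_mul]
    · intro j _ hj
      rw [QDiscord.onA, ← Matrix.mul_kronecker_mul, hP.orthogonal i j hj.symm]
      simp
    · simp
  have hTP : ∀ i, T * QDiscord.onA B (P i) = P i ⊗ₖ τ i := by
    intro i
    rw [hT, Finset.sum_mul, Finset.sum_eq_single i]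
    · rw [QDiscord.onA, ← Matrix.mul_kronecker_mul, hP.mul_self, mul_one]
    · intro j _ hj
      rw [QDiscord.onA, ← Matrix.mul_kronecker_mul, hP.orthogonal j i hj]
      simp
    · simp
  have h1 : ∀ i j, QDiscord.onA B (P i) * (QDiscord.onA B X * T) * QDiscord.onA B (P j) =
      (P i * X * P j) ⊗ₖ τ j := by
    intro i j
    rw [mul_assoc, mul_assoc, hTP, ← mul_assoc, ← onA_mul, QDiscord.onA,
      ← Matrix.mul_kronecker_mul, one_mul]
  have h2 : ∀ i j, QDiscord.onA B (P i) * (T * QDiscord.onA B X) * QDiscord.onA B (P j) =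
      (P i * X * P j) ⊗ₖ τ i := by
    intro i j
    rw [← mul_assoc, hPT, mul_assoc, ← onA_mul, QDiscord.onA, ← Matrix.mul_kronecker_mul,
      mul_one, mul_assoc]
  constructor
  · intro h i j hij
    have h3 : (P i * X * P j) ⊗ₖ (τ i - τ j) = 0 := by
      have h4 : (P i * X * P j) ⊗ₖ (τ i - τ j) =
          (P i * X * P j) ⊗ₖ τ i - (P i * X * P j) ⊗ₖ τ j := by
        ext x y
        simp [mul_sub]
      rw [h4, ← h1, ← h2, h.eq, sub_self]
    exact (kronecker_eq_zero h3).resolve_right (sub_ne_zero.2 hij)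
  · intro h
    rw [Commute, SemiconjBy, hP.onA.sum_mul_sum (QDiscord.onA B X * T),
      hP.onA.sum_mul_sum (T * QDiscord.onA B X)]
    refine Finset.sum_congr rfl fun i _ => Finset.sum_congr rfl fun j _ => ?_
    rw [h1, h2]
    by_cases hij : τ i = τ j
    · rw [hij]
    · rw [h i j hij]; simp

/-- The scalar analogue of `IsProjFamily.commute_onA_iff`: if `f` separates the same indices as `τ`,
commutation on the joint system becomes commutation on `A` alone. -/
lemma IsProjFamily.commute_sum_smul_iff {P : ι → Matrix A A ℂ} (hP : IsProjFamily P)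
    (X : Matrix A A ℂ) (f : ι → ℝ) :
    Commute X (∑ i, (f i : ℂ) • P i) ↔ ∀ i j, f i ≠ f j → P i * X * P j = 0 := by
  classical
  set N := ∑ i, (f i : ℂ) • P i with hN
  have hPN : ∀ i, P i * N = (f i : ℂ) • P i := by
    intro i
    rw [hN, Finset.mul_sum, Finset.sum_eq_single i]
    · rw [mul_smul_comm, hP.mul_self]
    · intro j _ hj
      rw [mul_smul_comm, hP.orthogonal i j hj.symm, smul_zero]
    · simp
  have hNP : ∀ i, N * P i = (f i : ℂ) • P i := by
    intro i
    rw [hN, Finset.sum_mul, Finset.sum_eq_single i]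
    · rw [smul_mul_assoc, hP.mul_self]
    · intro j _ hj
      rw [smul_mul_assoc, hP.orthogonal j i hj, smul_zero]
    · simp
  have h1 : ∀ i j, P i * (X * N) * P j = (f j : ℂ) • (P i * X * P j) := by
    intro i j
    rw [mul_assoc, mul_assoc, hNP, mul_smul_comm, mul_smul_comm, ← mul_assoc]
  have h2 : ∀ i j, P i * (N * X) * P j = (f i : ℂ) • (P i * X * P j) := by
    intro i j
    rw [← mul_assoc, hPN, smul_mul_assoc, smul_mul_assoc]
  constructor
  · intro h i j hij
    have h3 : ((f i : ℂ) - f j) • (P i * X * P j) = 0 := by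
      rw [sub_smul, ← h1, ← h2, h.eq, sub_self]
    refine (smul_eq_zero.1 h3).resolve_left (sub_ne_zero.2 ?_)
    exact_mod_cast hij
  · intro h
    rw [Commute, SemiconjBy, hP.sum_mul_sum (X * N), hP.sum_mul_sum (N * X)]
    refine Finset.sum_congr rfl fun i _ => Finset.sum_congr rfl fun j _ => ?_
    rw [h1, h2]
    by_cases hij : f i = f j
    · rw [hij]
    · rw [h i j hij]; simp

lemma IsProjFamily.isHermitian_sum_smul {P : ι → Matrix A A ℂ} (hP : IsProjFamily P)
    (f : ι → ℝ) : (∑ i, (f i : ℂ) • P i).IsHermitian := by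
  rw [Matrix.IsHermitian, Matrix.conjTranspose_sum]
  refine Finset.sum_congr rfl fun i _ => ?_
  rw [Matrix.conjTranspose_smul, (hP.isHermitian i).eq, Complex.star_def, Complex.conj_ofReal]

/-- A product of commuting matrices `ρ_A ⊗ 1` and `∑ i, P i ⊗ τ i` is block diagonal for some
measurement. -/
lemma IsProjFamily.exists_measurement {P : ι → Matrix A A ℂ} (hP : IsProjFamily P)
    {H : Matrix A A ℂ} (hH : H.IsHermitian) {τ : ι → Matrix B B ℂ}
    (hcomm : Commute (QDiscord.onA B H) (∑ i, P i ⊗ₖ τ i)) :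
    ∃ P' : A → Matrix A A ℂ, IsMeasurement P' ∧
      QDiscord.onA B H * ∑ i, P i ⊗ₖ τ i =
        ∑ k, QDiscord.onA B (P' k) * (QDiscord.onA B H * ∑ i, P i ⊗ₖ τ i) *
          QDiscord.onA B (P' k) := by
  -- `f` numbers the distinct values of `τ`. Projectors `P i` with equal `τ i` must share a label,
  -- since `H` may mix them.
  obtain ⟨f, hf⟩ : ∃ f : ι → ℝ, ∀ i j, f i = f j ↔ τ i = τ j := by
    refine ⟨fun i => ((Finite.equivFin (Set.range τ) ⟨τ i, Set.mem_range_self i⟩ : ℕ) : ℝ),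
      fun i j => ?_⟩
    rw [Nat.cast_inj, Fin.val_inj, EmbeddingLike.apply_eq_iff_eq, Subtype.mk.injEq]
  have hiff : ∀ X : Matrix A A ℂ, Commute X (∑ i, (f i : ℂ) • P i) ↔
      Commute (QDiscord.onA B X) (∑ i, P i ⊗ₖ τ i) := fun X => by
    rw [hP.commute_sum_smul_iff, hP.commute_onA_iff]
    simp only [ne_eq, hf]
  obtain ⟨P', hP', hc⟩ := exists_measurement_commute hH (hP.isHermitian_sum_smul f)
    ((hiff H).2 hcomm)
  refine ⟨P', hP', hP'.toIsProjFamily.onA.eq_sum_of_commute fun k => ?_⟩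
  refine Commute.mul_right ?_ ((hiff (P' k)).1 (hc k).2)
  rw [Commute, SemiconjBy, ← onA_mul, ← onA_mul, (hc k).1.eq]

end ProjFamilies

/-! ### Continuity and additivity of entropy, and pinching. -/

section Entropy

variable {n ι : Type*} [Fintype n] [DecidableEq n] [Fintype ι]

lemma entropy_eq_trace_cfc {M : Matrix n n ℂ} (hM : M.IsHermitian) :
    entropy M = (cfc (fun x => -(x * Real.logb 2 x)) M).trace.re := by
  rw [entropy, dif_pos hM, trace_cfc hM, Complex.re_sum]
  rfl

lemma log_two_mul_entropy {M : Matrix n n ℂ} (hM : M.IsHermitian) :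
    Real.log 2 * entropy M = -(cfc (fun x => x * Real.log x) M).trace.re := by
  have h2 : Real.log 2 ≠ 0 := (Real.log_pos one_lt_two).ne'
  rw [entropy, dif_pos hM, trace_cfc hM, Complex.re_sum, Finset.mul_sum, ← Finset.sum_neg_distrib]
  refine Finset.sum_congr rfl fun i _ => ?_
  rw [Complex.ofReal_re, Real.logb]
  field_simp

open scoped Matrix.Norms.L2Operator in
lemma continuous_entropy {X : Type*} [TopologicalSpace X] {a : X → Matrix n n ℂ}
    (ha : Continuous a) (hherm : ∀ x, (a x).IsHermitian) : Continuous fun x => entropy (a x) := by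
  have hf : Continuous fun x : ℝ => -(x * Real.logb 2 x) := by
    have h : (fun x : ℝ => -(x * Real.logb 2 x)) = fun x => -(x * Real.log x / Real.log 2) := by
      ext x
      rw [Real.logb, mul_div_assoc]
    rw [h]
    exact (Real.continuous_mul_log.div_const _).neg
  have h : Continuous fun x => cfc (fun x : ℝ => -(x * Real.logb 2 x)) (a x) :=
    Continuous.cfc_of_mem_nhdsSet (p := IsSelfAdjoint) (s := Set.univ) _ univ_mem ha
      (fun x => (hherm x).isSelfAdjoint) hf.continuousOn
  have h' : (fun x => entropy (a x)) =
      fun x => (cfc (fun x : ℝ => -(x * Real.logb 2 x)) (a x)).trace.re := by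
    ext x
    exact entropy_eq_trace_cfc (hherm x)
  rw [h']
  have htr : Continuous fun M : Matrix n n ℂ => M.trace.re := by fun_prop
  exact htr.comp h

lemma re_trace_eq_sum_eigenvalues {M : Matrix n n ℂ} (hM : M.IsHermitian) :
    M.trace.re = ∑ i, hM.eigenvalues i := by
  rw [hM.trace_eq_sum_eigenvalues, Complex.re_sum]
  rfl

/-- Removes the division by the outcome probability. The right side is continuous in `Q` even where
the trace vanishes, as the compactness argument requires. -/
lemma trace_mul_entropy_smul {Q : Matrix n n ℂ} (hQ : Q.PosSemidef) :
    Q.trace.re * entropy (((Q.trace.re : ℝ) : ℂ)⁻¹ • Q) =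
      entropy Q + Q.trace.re * Real.logb 2 Q.trace.re := by
  set p := Q.trace.re with hp
  rcases eq_or_ne p 0 with h0 | h0
  · have hQ0 : Q = 0 := by
      have him : Q.trace = (p : ℂ) :=
        Complex.ext rfl (by simpa using (Complex.nonneg_iff.1 hQ.trace_nonneg).2.symm)
      rw [h0, Complex.ofReal_zero] at him
      exact hQ.trace_eq_zero_iff.1 him
    rw [h0, hQ0, entropy_eq_trace_cfc Matrix.isHermitian_zero, trace_cfc Matrix.isHermitian_zero]
    have := (Matrix.isHermitian_zero (n := n) (α := ℂ)).eigenvalues_eq_zero_iff.2 rfl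
    simp [this]
  · have hsm : ((p : ℂ))⁻¹ • Q = (p⁻¹ : ℝ) • Q := by
      rw [← Complex.ofReal_inv, Complex.coe_smul]
    have hherm : ((p⁻¹ : ℝ) • Q).IsHermitian := hQ.isHermitian.smul (IsSelfAdjoint.all _)
    rw [hsm, entropy_eq_trace_cfc hherm, ← cfc_comp_const_mul p⁻¹ (fun x => -(x * Real.logb 2 x)) Q
      (((Matrix.finite_real_spectrum (A := Q)).image _).continuousOn _) hQ.isHermitian.isSelfAdjoint,
      trace_cfc hQ.isHermitian, entropy, dif_pos hQ.isHermitian, Complex.re_sum, Finset.mul_sum]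
    have hp' : p * Real.logb 2 p = ∑ i, hQ.isHermitian.eigenvalues i * Real.logb 2 p := by
      rw [← Finset.sum_mul, ← re_trace_eq_sum_eigenvalues]
    rw [hp', ← Finset.sum_add_distrib]
    refine Finset.sum_congr rfl fun i _ => ?_
    rw [Complex.ofReal_re]
    rcases eq_or_ne (hQ.isHermitian.eigenvalues i) 0 with h | h
    · simp [h]
    · rw [Real.logb_mul (inv_ne_zero h0) h, Real.logb_inv]
      field_simp
      ring

lemma aeval_eq_sum_coeff_smul (q : Polynomial ℝ) (M : Matrix n n ℂ) :
    Polynomial.aeval M q = ∑ k ∈ Finset.range (q.natDegree + 1), q.coeff k • M ^ k :=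
  Polynomial.aeval_eq_sum_range M

lemma sum_pow_succ_of_orthogonal {M : ι → Matrix n n ℂ} (hM : ∀ i j, i ≠ j → M i * M j = 0)
    (k : ℕ) : (∑ i, M i) ^ (k + 1) = ∑ i, M i ^ (k + 1) := by
  classical
  induction k with
  | zero => simp
  | succ k ih =>
    rw [pow_succ, ih, Finset.sum_mul]
    refine Finset.sum_congr rfl fun i _ => ?_
    rw [Finset.mul_sum, Finset.sum_eq_single i]
    · rw [← pow_succ]
    · intro j _ hj
      rw [pow_succ, mul_assoc, hM i j hj.symm, mul_zero]
    · simp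

/-- A polynomial without constant term represents `-x log₂ x` on all the spectra, and positive
powers of an orthogonal sum split. -/
lemma entropy_sum {M : ι → Matrix n n ℂ} (hM : ∀ i, (M i).IsHermitian)
    (horth : ∀ i j, i ≠ j → M i * M j = 0) : entropy (∑ i, M i) = ∑ i, entropy (M i) := by
  have hsum : (∑ i, M i).IsHermitian := by
    rw [Matrix.IsHermitian, Matrix.conjTranspose_sum]
    exact Finset.sum_congr rfl fun i _ => (hM i).eq
  obtain ⟨q, hq0, hq, hqi⟩ := exists_aeval_eq_cfc (fun x => -(x * Real.logb 2 x)) hsum hM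
  have hc0 : q.coeff 0 = 0 := by
    rw [Polynomial.coeff_zero_eq_eval_zero, hq0]
    simp
  rw [entropy_eq_trace_cfc hsum, ← hq,
    Finset.sum_congr rfl fun i _ => entropy_eq_trace_cfc (hM i)]
  simp only [← hqi, aeval_eq_sum_coeff_smul]
  rw [← Complex.re_sum, ← Matrix.trace_sum, Finset.sum_comm]
  congr 2
  refine Finset.sum_congr rfl fun k _ => ?_
  rw [← Finset.smul_sum]
  cases k with
  | zero => simp [hc0]
  | succ k => rw [sum_pow_succ_of_orthogonal horth]

lemma entropy_smul_proj {P : Matrix n n ℂ} (hP : P.IsHermitian) (hmul : P * P = P)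
    (htr : P.trace = 1) (p : ℝ) : entropy ((p : ℂ) • P) = -(p * Real.logb 2 p) := by
  have hsm : (p : ℂ) • P = p • P := Complex.coe_smul _ _
  have hherm : (p • P).IsHermitian := hP.smul (IsSelfAdjoint.all _)
  have hcfc : cfc (fun x => -((p * x) * Real.logb 2 (p * x))) P =
      cfc (fun x => -(p * Real.logb 2 p) * id x) P := by
    refine cfc_congr fun x hx => ?_
    rcases IsIdempotentElem.spectrum_subset ℝ hmul hx with rfl | rfl <;> simp
  rw [hsm, entropy_eq_trace_cfc hherm, ← cfc_comp_const_mul p (fun x => -(x * Real.logb 2 x)) P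
      (((Matrix.finite_real_spectrum (A := P)).image _).continuousOn _) hP.isSelfAdjoint, hcfc,
      cfc_const_mul _ _ P (continuousOn_spectrum _ _), cfc_id ℝ P hP.isSelfAdjoint,
      Matrix.trace_smul, htr]
  simp

/-- Pinching: with `R i` supported on the `i`-th block, `tr (ρ f(∑ R i))` only sees the diagonal
blocks of `ρ`. -/
lemma trace_mul_cfc_sum {Q R : ι → Matrix n n ℂ} (hQ : IsProjFamily Q)
    (hR : ∀ i, (R i).IsHermitian) (hQR : ∀ i, Q i * R i = R i) (ρ : Matrix n n ℂ) (f : ℝ → ℝ) :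
    (ρ * cfc f (∑ i, R i)).trace = ∑ i, (Q i * ρ * Q i * cfc f (R i)).trace := by
  have hRQ : ∀ i, R i * Q i = R i := fun i => by
    have h := congrArg Matrix.conjTranspose (hQR i)
    rwa [Matrix.conjTranspose_mul, (hR i).eq, (hQ.isHermitian i).eq] at h
  have horth : ∀ i j, i ≠ j → R i * R j = 0 := fun i j hij => by
    rw [← hRQ i, ← hQR j, mul_assoc, ← mul_assoc (Q i), hQ.orthogonal i j hij, zero_mul, mul_zero]
  have hsum : (∑ i, R i).IsHermitian := by
    rw [Matrix.IsHermitian, Matrix.conjTranspose_sum]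
    exact Finset.sum_congr rfl fun i _ => (hR i).eq
  obtain ⟨q, -, hq, hqi⟩ := exists_aeval_eq_cfc f hsum hR
  simp only [← hq, ← hqi, aeval_eq_sum_coeff_smul, Finset.mul_sum, Matrix.trace_sum,
    mul_smul_comm, Matrix.trace_smul]
  rw [Finset.sum_comm]
  refine Finset.sum_congr rfl fun k _ => ?_
  rw [← Finset.smul_sum]
  congr 1
  -- `f 0` may be nonzero here, so the constant term counts; it agrees because pinching preserves
  -- the trace.
  cases k with
  | zero =>
    have h : ∀ i, (Q i * ρ * Q i).trace = (Q i * ρ).trace := fun i => by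
      rw [Matrix.trace_mul_comm, ← mul_assoc, hQ.mul_self]
    simp only [pow_zero, mul_one, h]
    rw [← Matrix.trace_sum, ← Finset.sum_mul, hQ.complete, one_mul]
  | succ k =>
    rw [sum_pow_succ_of_orthogonal horth, Finset.mul_sum, Matrix.trace_sum]
    refine Finset.sum_congr rfl fun i _ => ?_
    have h1 : Q i * R i ^ (k + 1) = R i ^ (k + 1) := by
      rw [pow_succ', ← mul_assoc, hQR]
    have h2 : R i ^ (k + 1) * Q i = R i ^ (k + 1) := by
      rw [pow_succ, mul_assoc, hRQ]
    rw [mul_assoc (Q i * ρ), h1, mul_assoc, Matrix.trace_mul_comm (Q i), mul_assoc, h2]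

end Entropy

/-! ### Kraus operators and the reduced evolution. -/

section Kraus

variable {A B ι κ : Type*} [Fintype A] [DecidableEq A] [Fintype B] [DecidableEq B]
  [Fintype ι] [Fintype κ]

lemma one_kronecker_mul_mul_apply {C : Type*} [Fintype C] [DecidableEq C] (K L : Matrix A A ℂ)
    (X : Matrix (C × A) (C × A) ℂ) (x y : C × A) :
    (((1 : Matrix C C ℂ) ⊗ₖ K) * X * ((1 : Matrix C C ℂ) ⊗ₖ L)) x y =
      (K * (Matrix.of fun a a' => X (x.1, a) (y.1, a')) * L) x.2 y.2 := by
  obtain ⟨c, a⟩ := x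
  obtain ⟨d, b⟩ := y
  simp [Matrix.mul_apply, Fintype.sum_prod_type, Matrix.one_apply, Finset.sum_mul]

lemma isCPTP_krausMap {K : κ → Matrix A A ℂ} (hK : ∑ k, (K k)ᴴ * K k = 1) :
    IsCPTP (krausMap K) where
  trace_preserving X := by
    have h : ∀ k, (K k * X * (K k)ᴴ).trace = ((K k)ᴴ * K k * X).trace := fun k => by
      rw [Matrix.trace_mul_comm, ← mul_assoc]
    change (∑ k, K k * X * (K k)ᴴ).trace = _
    rw [Matrix.trace_sum, Finset.sum_congr rfl fun k _ => h k, ← Matrix.trace_sum,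
      ← Finset.sum_mul, hK, one_mul]
  positive X hX := Matrix.posSemidef_sum _ fun k _ => hX.mul_mul_conjTranspose_same (K k)
  completely_positive m X hX := by
    have h : ampliation (Fin m) (krausMap K) X =
        ∑ k, ((1 : Matrix (Fin m) (Fin m) ℂ) ⊗ₖ K k) * X *
          ((1 : Matrix (Fin m) (Fin m) ℂ) ⊗ₖ K k)ᴴ := by
      ext x y
      rw [Matrix.sum_apply]
      simp only [Matrix.conjTranspose_kronecker, Matrix.conjTranspose_one,
        one_kronecker_mul_mul_apply]
      exact Matrix.sum_apply _ _ _ _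
    rw [h]
    exact Matrix.posSemidef_sum _ fun k _ => hX.mul_mul_conjTranspose_same _

lemma sum_orthonormalBasis_mul_star (e : OrthonormalBasis B ℂ (EuclideanSpace ℂ B)) (x y : B) :
    ∑ n, e n x * star (e n y) = if x = y then 1 else 0 := by
  let E : Matrix B B ℂ := Matrix.of fun x n => e n x
  have hE : E ∈ Matrix.unitaryGroup B ℂ := by
    rw [Matrix.mem_unitaryGroup_iff']
    ext i j
    have h := orthonormal_iff_ite.1 e.orthonormal i j
    rw [Matrix.mul_apply, Matrix.one_apply, ← h, PiLp.inner_apply]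
    refine Finset.sum_congr rfl fun k _ => ?_
    simp [E, Matrix.star_apply, mul_comm]
  have h := congrFun (congrFun (Matrix.mem_unitaryGroup_iff.1 hE) x) y
  rw [Matrix.mul_apply, Matrix.one_apply] at h
  simpa [E, Matrix.star_apply] using h

lemma sum_mulVec_orthonormalBasis_mul_star (e : OrthonormalBasis B ℂ (EuclideanSpace ℂ B))
    (S : Matrix B B ℂ) (x y : B) :
    ∑ m, (S *ᵥ (e m)) x * star ((S *ᵥ (e m)) y) = (S * Sᴴ) x y := by
  have h : ∀ m, (S *ᵥ (e m)) x * star ((S *ᵥ (e m)) y) =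
      ∑ z, ∑ w, S x z * star (S y w) * (e m z * star (e m w)) := by
    intro m
    simp only [Matrix.mulVec, dotProduct, star_sum, star_mul, Finset.sum_mul_sum]
    refine Finset.sum_congr rfl fun z _ => Finset.sum_congr rfl fun w _ => ?_
    ring
  simp only [h]
  rw [Finset.sum_comm]
  simp only [Finset.sum_comm (γ := B) (s := Finset.univ (α := B)) (t := Finset.univ (α := B))
    (f := fun m w => S x _ * star (S y w) * (e m _ * star (e m w))), ← Finset.mul_sum,
    sum_orthonormalBasis_mul_star, Matrix.mul_apply, Matrix.conjTranspose_apply]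
  simp

lemma conjTranspose_braB (v : B → ℂ) : (braB A v)ᴴ = ketB A v := by
  rw [braB, Matrix.conjTranspose_conjTranspose]

lemma conjTranspose_ketB (v : B → ℂ) : (ketB A v)ᴴ = braB A v := rfl

lemma ketB_mul_mul_braB (X : Matrix A A ℂ) (v w : B → ℂ) :
    ketB A v * X * braB A w = X ⊗ₖ Matrix.vecMulVec v (star w) := by
  ext x y
  simp [ketB, braB, Matrix.mul_apply, Matrix.vecMulVec_apply, apply_ite (starRingEnd ℂ), mul_comm]
  ring

lemma braB_mul_ketB (v w : B → ℂ) :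
    braB A v * ketB A w = (∑ x, star (v x) * w x) • (1 : Matrix A A ℂ) := by
  ext a b
  by_cases h : a = b
  · subst h
    simp [ketB, braB, Matrix.mul_apply, Fintype.sum_prod_type]
  · simp [ketB, braB, Matrix.mul_apply, Fintype.sum_prod_type, h, Ne.symm h]

lemma sum_ketB_mul_braB (e : OrthonormalBasis B ℂ (EuclideanSpace ℂ B)) :
    ∑ n, ketB A (e n) * braB A (e n) = 1 := by
  have h : ∀ n, ketB A (e n) * braB A (e n) =
      (1 : Matrix A A ℂ) ⊗ₖ Matrix.vecMulVec (e n) (star (e n).ofLp) := fun n => by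
    rw [← ketB_mul_mul_braB, Matrix.mul_one]
  ext x y
  have hs := sum_orthonormalBasis_mul_star e x.2 y.2
  simp only [h, Matrix.sum_apply, Matrix.kroneckerMap_apply, Matrix.vecMulVec_apply, ← Finset.mul_sum,
    Pi.star_apply, hs]
  simp only [Matrix.one_apply, Prod.ext_iff]
  by_cases h1 : x.1 = y.1 <;> by_cases h2 : x.2 = y.2 <;> simp [h1, h2]

lemma sum_braB_mul_mul_ketB (e : OrthonormalBasis B ℂ (EuclideanSpace ℂ B))
    (Y : Matrix (A × B) (A × B) ℂ) : ∑ n, braB A (e n) * Y * ketB A (e n) = trB Y := by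
  have h : ∀ n (a b : A), (braB A (e n) * Y * ketB A (e n)) a b =
      ∑ x, ∑ y, Y (a, x) (b, y) * (e n y * star (e n x)) := by
    intro n a b
    simp only [ketB, braB, Matrix.mul_apply, Fintype.sum_prod_type, Matrix.conjTranspose_apply,
      Matrix.of_apply, Finset.sum_mul]
    simp only [apply_ite star, star_zero, ite_mul, zero_mul, mul_ite, mul_zero,
      Finset.sum_ite_irrel, Finset.sum_const_zero, Finset.sum_ite_eq', Finset.mem_univ, if_true]
    rw [Finset.sum_comm]
    refine Finset.sum_congr rfl fun x _ => Finset.sum_congr rfl fun y _ => ?_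
    ring
  ext a b
  rw [Matrix.sum_apply]
  simp only [h]
  rw [Finset.sum_comm]
  simp only [trB, Matrix.of_apply]
  refine Finset.sum_congr rfl fun x _ => ?_
  rw [Finset.sum_comm]
  simp only [← Finset.mul_sum, sum_orthonormalBasis_mul_star]
  simp

lemma trB_sum (Y : ι → Matrix (A × B) (A × B) ℂ) : trB (∑ j, Y j) = ∑ j, trB (Y j) := by
  ext a b
  simp only [trB, Matrix.of_apply, Matrix.sum_apply]
  exact Finset.sum_comm

lemma trB_smul (c : ℂ) (Y : Matrix (A × B) (A × B) ℂ) : trB (c • Y) = c • trB Y := by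
  ext a b
  simp [trB, Finset.mul_sum]

lemma trB_kronecker (M : Matrix A A ℂ) (N : Matrix B B ℂ) : trB (M ⊗ₖ N) = N.trace • M := by
  ext a b
  simp [trB, Matrix.trace, ← Finset.mul_sum, mul_comm]

lemma trB_cqMatrix (q : ι → ℝ) (P : ι → Matrix A A ℂ) {τ : ι → Matrix B B ℂ}
    (hτ : ∀ j, IsState (τ j)) : trB (cqMatrix q P τ) = ∑ j, (q j : ℂ) • P j := by
  rw [cqMatrix, trB_sum]
  refine Finset.sum_congr rfl fun j _ => ?_
  rw [trB_smul, trB_kronecker, (hτ j).trace_eq_one, one_smul]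

lemma sqrt_mul_conjTranspose_sqrt {τ : Matrix B B ℂ} (hτ : τ.PosSemidef) :
    CFC.sqrt τ * (CFC.sqrt τ)ᴴ = τ := by
  have h0 : 0 ≤ τ := Matrix.nonneg_iff_posSemidef.2 hτ
  have h1 : (CFC.sqrt τ).PosSemidef := Matrix.nonneg_iff_posSemidef.1 (CFC.sqrt_nonneg τ)
  rw [h1.isHermitian.eq, CFC.sqrt_mul_sqrt_self τ h0]

/-- The isometry-like operators `∑ l, (√τ_l |m⟩)^B Π_l`. -/
noncomputable def preparation (P : ι → Matrix A A ℂ) (τ : ι → Matrix B B ℂ) (v : B → ℂ) :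
    Matrix (A × B) A ℂ :=
  ∑ l, ketB A (CFC.sqrt (τ l) *ᵥ v) * P l

lemma krausOp_eq (P : ι → Matrix A A ℂ) (τ : ι → Matrix B B ℂ) (U : Matrix (A × B) (A × B) ℂ)
    (e : OrthonormalBasis B ℂ (EuclideanSpace ℂ B)) (n m : B) :
    krausOp P τ U e (n, m) = braB A (e n) * (U * preparation P τ (e m)) := by
  rw [krausOp, preparation, Matrix.mul_sum, Matrix.mul_sum]
  refine Finset.sum_congr rfl fun l _ => ?_
  simp only [Matrix.mul_assoc]

/-- Orthogonality kills the cross terms, and the coefficient of `P l` sums to `tr τ_l = 1`. -/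
lemma sum_preparation_conjTranspose_mul {P : ι → Matrix A A ℂ} (hP : IsProjFamily P)
    {τ : ι → Matrix B B ℂ} (hτ : ∀ j, IsState (τ j))
    (e : OrthonormalBasis B ℂ (EuclideanSpace ℂ B)) :
    ∑ m, (preparation P τ (e m))ᴴ * preparation P τ (e m) = 1 := by
  classical
  have h : ∀ m, (preparation P τ (e m))ᴴ * preparation P τ (e m) = ∑ l, (∑ x,
      (CFC.sqrt (τ l) *ᵥ e m) x * star ((CFC.sqrt (τ l) *ᵥ e m) x)) • P l := by
    intro m
    rw [preparation, Matrix.conjTranspose_sum, Matrix.sum_mul]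
    refine Finset.sum_congr rfl fun l _ => ?_
    rw [Matrix.mul_sum, Finset.sum_eq_single l]
    · rw [Matrix.conjTranspose_mul, (hP.isHermitian l).eq, conjTranspose_ketB, Matrix.mul_assoc,
        ← Matrix.mul_assoc (braB A _), braB_mul_ketB, smul_mul_assoc, one_mul, mul_smul_comm,
        hP.mul_self]
      simp only [mul_comm]
    · intro k _ hk
      rw [Matrix.conjTranspose_mul, (hP.isHermitian l).eq, conjTranspose_ketB, Matrix.mul_assoc,
        ← Matrix.mul_assoc (braB A _), braB_mul_ketB, smul_mul_assoc, one_mul, mul_smul_comm,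
        hP.orthogonal l k hk.symm, smul_zero]
    · simp
  simp only [h]
  rw [Finset.sum_comm, ← hP.complete]
  refine Finset.sum_congr rfl fun l _ => ?_
  rw [← Finset.sum_smul, Finset.sum_comm]
  simp only [sum_mulVec_orthonormalBasis_mul_star, sqrt_mul_conjTranspose_sqrt (hτ l).posSemidef]
  have ht : ∑ x, τ l x x = 1 := (hτ l).trace_eq_one
  rw [ht, one_smul]

lemma preparation_mul {P : ι → Matrix A A ℂ} (hP : IsProjFamily P) (τ : ι → Matrix B B ℂ)
    (v : B → ℂ) (j : ι) : preparation P τ v * P j = ketB A (CFC.sqrt (τ j) *ᵥ v) * P j := by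
  classical
  rw [preparation, Matrix.sum_mul, Finset.sum_eq_single j]
  · rw [Matrix.mul_assoc, hP.mul_self]
  · intro k _ hk
    rw [Matrix.mul_assoc, hP.orthogonal k j hk, Matrix.mul_zero]
  · simp

/-- `P j` selects the factor `√τ_j`, and summing over the basis yields `√τ_j √τ_j†`. By linearity
the joint state is rebuilt from `trB`. -/
lemma sum_preparation_mul_mul {P : ι → Matrix A A ℂ} (hP : IsProjFamily P)
    {τ : ι → Matrix B B ℂ} (hτ : ∀ j, IsState (τ j))
    (e : OrthonormalBasis B ℂ (EuclideanSpace ℂ B)) (j : ι) :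
    ∑ m, preparation P τ (e m) * P j * (preparation P τ (e m))ᴴ = P j ⊗ₖ τ j := by
  have h : ∀ m, preparation P τ (e m) * P j * (preparation P τ (e m))ᴴ = P j ⊗ₖ
      Matrix.vecMulVec (CFC.sqrt (τ j) *ᵥ e m) (star (CFC.sqrt (τ j) *ᵥ e m)) := by
    intro m
    have h1 : P j * (preparation P τ (e m))ᴴ = P j * braB A (CFC.sqrt (τ j) *ᵥ e m) := by
      have h2 := congrArg Matrix.conjTranspose (preparation_mul hP τ (e m) j)
      rwa [Matrix.conjTranspose_mul, Matrix.conjTranspose_mul, (hP.isHermitian j).eq,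
        conjTranspose_ketB] at h2
    rw [Matrix.mul_assoc, h1, ← Matrix.mul_assoc, preparation_mul hP, ketB_mul_mul_braB]
  ext x y
  have hs := sum_mulVec_orthonormalBasis_mul_star e (CFC.sqrt (τ j)) x.2 y.2
  rw [sqrt_mul_conjTranspose_sqrt (hτ j).posSemidef] at hs
  simp only [h, Matrix.sum_apply, Matrix.kroneckerMap_apply, Matrix.vecMulVec_apply,
    Pi.star_apply, ← Finset.mul_sum, hs]

lemma sum_krausOp_conjTranspose_mul {P : ι → Matrix A A ℂ} (hP : IsProjFamily P)
    {τ : ι → Matrix B B ℂ} (hτ : ∀ j, IsState (τ j)) {U : Matrix (A × B) (A × B) ℂ}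
    (hU : U ∈ Matrix.unitaryGroup (A × B) ℂ) (e : OrthonormalBasis B ℂ (EuclideanSpace ℂ B)) :
    ∑ α, (krausOp P τ U e α)ᴴ * krausOp P τ U e α = 1 := by
  have hUU : Uᴴ * U = 1 := Matrix.mem_unitaryGroup_iff'.1 hU
  rw [Fintype.sum_prod_type_right, ← sum_preparation_conjTranspose_mul hP hτ e]
  refine Finset.sum_congr rfl fun m _ => ?_
  set W := preparation P τ (e m)
  have h : ∀ n, (krausOp P τ U e (n, m))ᴴ * krausOp P τ U e (n, m) =
      (U * W)ᴴ * (ketB A (e n) * braB A (e n)) * (U * W) := by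
    intro n
    rw [krausOp_eq, Matrix.conjTranspose_mul, conjTranspose_braB]
    simp only [Matrix.mul_assoc, W]
  rw [Finset.sum_congr rfl fun n _ => h n, ← Matrix.sum_mul, ← Matrix.mul_sum, sum_ketB_mul_braB,
    Matrix.mul_one, Matrix.conjTranspose_mul, Matrix.mul_assoc, ← Matrix.mul_assoc Uᴴ, hUU,
    Matrix.one_mul]

lemma reducedEvolution_cqMatrix {P : ι → Matrix A A ℂ} (hP : IsProjFamily P)
    {τ : ι → Matrix B B ℂ} (hτ : ∀ j, IsState (τ j)) (U : Matrix (A × B) (A × B) ℂ)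
    (e : OrthonormalBasis B ℂ (EuclideanSpace ℂ B)) (q : ι → ℝ) :
    reducedEvolution U (cqMatrix q P τ) =
      ∑ α, krausOp P τ U e α * trB (cqMatrix q P τ) * (krausOp P τ U e α)ᴴ := by
  have hcq : cqMatrix q P τ = ∑ m, preparation P τ (e m) * trB (cqMatrix q P τ) *
      (preparation P τ (e m))ᴴ := by
    simp only [trB_cqMatrix q P hτ, Matrix.mul_sum, Matrix.sum_mul, Matrix.mul_smul,
      Matrix.smul_mul]
    rw [Finset.sum_comm]
    simp only [← Finset.smul_sum, sum_preparation_mul_mul hP hτ e]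
    rfl
  set X := trB (cqMatrix q P τ)
  rw [reducedEvolution, hcq, ← sum_braB_mul_mul_ketB e, Fintype.sum_prod_type]
  refine Finset.sum_congr rfl fun n _ => ?_
  simp only [Matrix.mul_sum, Matrix.sum_mul]
  refine Finset.sum_congr rfl fun m _ => ?_
  rw [krausOp_eq, Matrix.conjTranspose_mul, Matrix.conjTranspose_mul, conjTranspose_braB]
  simp only [Matrix.mul_assoc]

end Kraus

/-! ### Nonnegativity, zeros and attainment of the discord. -/

section Discord

variable {A B ι : Type*} [Fintype A] [DecidableEq A] [Fintype B] [DecidableEq B] [Fintype ι]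

lemma trace_mul_onA (ρ : Matrix (A × B) (A × B) ℂ) (X : Matrix A A ℂ) :
    (ρ * onA B X).trace = (trB ρ * X).trace := by
  simp only [Matrix.trace, Matrix.diag_apply, Matrix.mul_apply, onA, trB, Matrix.of_apply,
    Fintype.sum_prod_type, Matrix.kroneckerMap_apply, Matrix.one_apply, mul_ite, mul_one, mul_zero,
    Finset.sum_ite_eq', Finset.mem_univ, if_true, Finset.sum_mul]
  exact Finset.sum_congr rfl fun a _ => Finset.sum_comm

lemma posSemidef_trB {ρ : Matrix (A × B) (A × B) ℂ} (hρ : ρ.PosSemidef) : (trB ρ).PosSemidef := by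
  have h : trB ρ = ∑ i : B, ρ.submatrix (fun a => (a, i)) fun a => (a, i) := by
    ext a b
    simp [trB, Matrix.sum_apply]
  rw [h]
  exact Matrix.posSemidef_sum _ fun i _ => hρ.submatrix _

lemma onA_smul (c : ℝ) (M : Matrix A A ℂ) : onA B (c • M) = c • onA B M := by
  ext x y
  simp [onA, mul_assoc]

lemma onA_pow (M : Matrix A A ℂ) (k : ℕ) : onA B (M ^ k) = onA B M ^ k := by
  induction k with
  | zero => simp [onA_one]
  | succ k ih => rw [pow_succ, pow_succ, onA_mul, ih]

lemma cfc_onA {M : Matrix A A ℂ} (hM : M.IsHermitian) (f : ℝ → ℝ) :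
    cfc f (onA B M) = onA B (cfc f M) := by
  obtain ⟨q, -, hq, hq'⟩ := exists_aeval_eq_cfc f (isHermitian_onA (B := B) hM)
    (N := fun _ : Unit => M) fun _ => hM
  rw [← hq, ← hq' (), aeval_eq_sum_coeff_smul, aeval_eq_sum_coeff_smul, onA_sum]
  exact Finset.sum_congr rfl fun k _ => by rw [onA_smul, onA_pow]

/-- There is no dependence on `δ`: the trace reduces to `ρ_A * regLog δ (ρ_A)`, and the factor `x`
annihilates the value at `0`. -/
lemma trace_mul_onA_cfc_regLog {ρ : Matrix (A × B) (A × B) ℂ} (hρ : ρ.PosSemidef) (δ : ℝ) :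
    (ρ * cfc (regLog δ) (onA B (trB ρ))).trace.re =
      -(Real.log 2 * entropy (trB ρ)) := by
  have hA := (posSemidef_trB hρ).isHermitian
  rw [cfc_onA hA, trace_mul_onA, log_two_mul_entropy hA, neg_neg]
  nth_rewrite 1 [← cfc_id ℝ (trB ρ) hA.isSelfAdjoint]
  rw [cfc_mul_apply]
  congr 2
  refine cfc_congr fun x _ => ?_
  by_cases h : x = 0 <;> simp [regLog, h]

/-- The blocks of a state for a measurement on `A` are the matrices `P i ⊗ σ i`. -/
lemma IsMeasurement.exists_block {P : A → Matrix A A ℂ} (hP : IsMeasurement P)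
    {ρ : Matrix (A × B) (A × B) ℂ} (hρ : ρ.PosSemidef) :
    ∃ σ : A → Matrix B B ℂ, ∀ i, (σ i).PosSemidef ∧
      onA B (P i) * ρ * onA B (P i) = P i ⊗ₖ σ i ∧ (σ i).trace = (outcomeProb ρ (P i) : ℂ) := by
  have htr := hP.trace_eq_one
  have hmul := hP.mul_self
  obtain ⟨V, hV, rfl⟩ := hP.exists_unitary
  -- `k i` is the isometry tensoring with the `i`-th basis vector, so `P i ⊗ 1 = k i * (k i)ᴴ` and
  -- the block is `ρ` compressed by `k i`.
  let k : A → Matrix (A × B) B ℂ := fun i => Matrix.of fun x y => if x.2 = y then V x.1 i else 0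
  have hk : ∀ i (S : Matrix B B ℂ), k i * S * (k i)ᴴ = basisMeasurement V i ⊗ₖ S := by
    intro i S
    ext x y
    simp [k, Matrix.mul_apply, basisMeasurement_apply, apply_ite (starRingEnd ℂ)]
    ring
  have hk1 : ∀ i, onA B (basisMeasurement V i) = k i * (k i)ᴴ := fun i => by
    rw [onA, ← hk, Matrix.mul_one]
  refine ⟨fun i => (k i)ᴴ * ρ * k i, fun i => ?_⟩
  have hσ : ((k i)ᴴ * ρ * k i).PosSemidef := hρ.conjTranspose_mul_mul_same (k i)
  have hblock : onA B (basisMeasurement V i) * ρ * onA B (basisMeasurement V i) =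
      basisMeasurement V i ⊗ₖ ((k i)ᴴ * ρ * k i) := by
    rw [← hk, hk1]
    simp only [Matrix.mul_assoc]
  refine ⟨hσ, hblock, ?_⟩
  have h1 : (onA B (basisMeasurement V i) * ρ).trace = ((k i)ᴴ * ρ * k i).trace := by
    have h2 := congrArg Matrix.trace hblock
    rwa [Matrix.trace_kronecker, htr, one_mul, Matrix.trace_mul_comm, ← mul_assoc, ← onA_mul,
      hmul] at h2
  rw [outcomeProb, h1]
  exact Complex.ext rfl (by simpa using (Complex.nonneg_iff.1 hσ.trace_nonneg).2.symm)

lemma mutualI_sub_mutualJ (ρ : Matrix (A × B) (A × B) ℂ) (P : A → Matrix A A ℂ) :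
    mutualI ρ - mutualJ ρ P = entropy (trB ρ) - entropy ρ + condEntropy ρ P := by
  rw [mutualI, mutualJ]
  ring

lemma IsProjFamily.sum_outcomeProb {P : ι → Matrix A A ℂ} (hP : IsProjFamily P)
    (ρ : Matrix (A × B) (A × B) ℂ) : ∑ i, outcomeProb ρ (P i) = ρ.trace.re := by
  simp only [outcomeProb]
  rw [← Complex.re_sum, ← Matrix.trace_sum, ← Finset.sum_mul, hP.onA.complete, one_mul]

/-- The difference `I - J` is nonnegative, and it vanishes only for block diagonal states. -/
lemma IsMeasurement.mutualI_sub_mutualJ_nonneg {P : A → Matrix A A ℂ} (hP : IsMeasurement P)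
    {ρ : Matrix (A × B) (A × B) ℂ} (hρ : IsState ρ) :
    0 ≤ mutualI ρ - mutualJ ρ P ∧ (mutualI ρ - mutualJ ρ P = 0 →
      ∃ P' : A → Matrix A A ℂ, IsMeasurement P' ∧
        ρ = ∑ i, onA B (P' i) * ρ * onA B (P' i)) := by
  obtain ⟨σ, hσ⟩ := hP.exists_block hρ.posSemidef
  set p : A → ℝ := fun i => outcomeProb ρ (P i) with hp
  have hp0 : ∀ i, 0 ≤ p i := fun i => by
    have h := (hσ i).1.trace_nonneg
    rw [(hσ i).2.2] at h
    exact_mod_cast h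
  -- For `p i = 0` the inverse is `0`, so `τ i = 0` and the outcome contributes nothing to `T`.
  set τ : A → Matrix B B ℂ := fun i => ((p i : ℂ))⁻¹ • σ i with hτ
  have hpost : ∀ i, postState ρ (P i) = P i ⊗ₖ τ i := fun i => by
    rw [postState, (hσ i).2.1, hτ, Matrix.kronecker_smul]
  have hblock : ∀ i, onA B (P i) * ρ * onA B (P i) = (p i : ℂ) • postState ρ (P i) := by
    intro i
    rcases eq_or_ne (p i) 0 with h | h
    · have h0 : σ i = 0 := (hσ i).1.trace_eq_zero_iff.1 (by
        rw [(hσ i).2.2]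
        exact_mod_cast h)
      rw [h, (hσ i).2.1, h0]
      simp
    · rw [postState, smul_smul, mul_inv_cancel₀ (by exact_mod_cast h), one_smul]
  have hpostPSD : ∀ i, (postState ρ (P i)).PosSemidef := fun i => by
    rw [postState, ← Complex.ofReal_inv]
    refine Matrix.PosSemidef.smul ?_ (by exact_mod_cast inv_nonneg.2 (hp0 i))
    have h := hρ.posSemidef.mul_mul_conjTranspose_same (onA B (P i))
    rwa [(isHermitian_onA (hP.isHermitian i)).eq] at h
  have hRA : (onA B (trB ρ)).PosSemidef := (posSemidef_trB hρ.posSemidef).kronecker .one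
  have hb : ∀ δ, (ρ * cfc (regLog δ) (∑ i, postState ρ (P i))).trace.re =
      -(Real.log 2 * condEntropy ρ P) := by
    intro δ
    rw [trace_mul_cfc_sum hP.toIsProjFamily.onA (fun i => (hpostPSD i).isHermitian)
      (fun i => by rw [postState, mul_smul_comm, ← mul_assoc, ← mul_assoc, ← onA_mul, hP.mul_self])
      ρ, Complex.re_sum, condEntropy, Finset.mul_sum, ← Finset.sum_neg_distrib]
    refine Finset.sum_congr rfl fun i _ => ?_
    have hherm := (hpostPSD i).isHermitian
    have h1 : postState ρ (P i) * cfc (regLog δ) (postState ρ (P i)) =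
        cfc (fun x => x * Real.log x) (postState ρ (P i)) := by
      nth_rewrite 1 [← cfc_id ℝ (postState ρ (P i)) hherm.isSelfAdjoint]
      rw [cfc_mul_apply]
      refine cfc_congr fun x _ => ?_
      by_cases h : x = 0 <;> simp [regLog, h]
    rw [hblock, smul_mul_assoc, h1, Matrix.trace_smul, smul_eq_mul, Complex.re_ofReal_mul,
      mul_left_comm, log_two_mul_entropy hherm, hp]
    ring
  have htr : (onA B (trB ρ) * ∑ i, postState ρ (P i)).trace.re = ρ.trace.re := by
    rw [← hP.toIsProjFamily.sum_outcomeProb ρ, Finset.mul_sum, Matrix.trace_sum, Complex.re_sum]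
    refine Finset.sum_congr rfl fun i _ => ?_
    have h1 : (trB ρ * P i).trace.re = p i := by
      rw [← trace_mul_onA, Matrix.trace_mul_comm]
      rfl
    rw [hpost, onA, ← Matrix.mul_kronecker_mul, one_mul, Matrix.trace_kronecker, hτ,
      Matrix.trace_smul, (hσ i).2.2, smul_eq_mul]
    change (_ * ((p i : ℂ)⁻¹ * (p i : ℂ))).re = p i
    rcases eq_or_ne (p i) 0 with h | h
    · simp [h]
    · rw [inv_mul_cancel₀ (by exact_mod_cast h), mul_one, h1]
  have key := relativeEntropy_regLog hρ.posSemidef hRA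
    (Matrix.posSemidef_sum _ fun i _ => hpostPSD i) htr
    (trace_mul_onA_cfc_regLog hρ.posSemidef) hb
  have hval : (cfc (fun x => x * Real.log x) ρ).trace.re - -(Real.log 2 * entropy (trB ρ)) -
      -(Real.log 2 * condEntropy ρ P) = Real.log 2 * (mutualI ρ - mutualJ ρ P) := by
    rw [mutualI_sub_mutualJ]
    linarith [log_two_mul_entropy hρ.posSemidef.isHermitian]
  rw [hval] at key
  refine ⟨nonneg_of_mul_nonneg_right key.1 (Real.log_pos one_lt_two), fun h0 => ?_⟩
  obtain ⟨hcomm, hprod⟩ := key.2 (by rw [h0, mul_zero])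
  simp only [hpost] at hcomm hprod
  obtain ⟨P', hP', h⟩ := hP.toIsProjFamily.exists_measurement
    (posSemidef_trB hρ.posSemidef).isHermitian hcomm
  rw [← hprod] at h
  exact ⟨P', hP', h⟩

lemma IsMeasurement.condEntropy_eq {P : A → Matrix A A ℂ} (hP : IsMeasurement P)
    {ρ : Matrix (A × B) (A × B) ℂ} (hρ : ρ.PosSemidef) :
    condEntropy ρ P = ∑ i, (entropy (onA B (P i) * ρ * onA B (P i)) +
      outcomeProb ρ (P i) * Real.logb 2 (outcomeProb ρ (P i))) := by
  refine Finset.sum_congr rfl fun i _ => ?_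
  have h := hρ.mul_mul_conjTranspose_same (onA B (P i))
  rw [(isHermitian_onA (hP.isHermitian i)).eq] at h
  have htr : (onA B (P i) * ρ * onA B (P i)).trace.re = outcomeProb ρ (P i) := by
    rw [Matrix.trace_mul_comm, ← mul_assoc, ← onA_mul, hP.mul_self, outcomeProb]
  have h2 := trace_mul_entropy_smul h
  rwa [htr] at h2

/-- For a block diagonal state the measurement in question has `I = J`. -/
lemma IsMeasurement.mutualI_sub_mutualJ_eq_zero {P : A → Matrix A A ℂ} (hP : IsMeasurement P)
    {ρ : Matrix (A × B) (A × B) ℂ} (hρ : ρ.PosSemidef)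
    (h : ρ = ∑ i, onA B (P i) * ρ * onA B (P i)) : mutualI ρ - mutualJ ρ P = 0 := by
  obtain ⟨σ, hσ⟩ := hP.exists_block hρ
  have hherm : ∀ i, (onA B (P i) * ρ * onA B (P i)).IsHermitian := fun i => by
    have h := (hρ.mul_mul_conjTranspose_same (onA B (P i))).isHermitian
    rwa [(isHermitian_onA (hP.isHermitian i)).eq] at h
  have hS : entropy ρ = ∑ i, entropy (onA B (P i) * ρ * onA B (P i)) := by
    conv_lhs => rw [h]
    refine entropy_sum hherm fun i j hij => ?_
    have h0 := hP.toIsProjFamily.onA (B := B) |>.orthogonal i j hij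
    rw [mul_assoc, ← mul_assoc (onA B (P i)) (onA B (P j) * ρ), ← mul_assoc (onA B (P i)), h0]
    simp
  have hA : trB ρ = ∑ i, (outcomeProb ρ (P i) : ℂ) • P i := by
    conv_lhs => rw [h]
    rw [trB_sum]
    refine Finset.sum_congr rfl fun i _ => ?_
    rw [(hσ i).2.1, trB_kronecker, (hσ i).2.2]
  have hSA : entropy (trB ρ) = ∑ i, -(outcomeProb ρ (P i) * Real.logb 2 (outcomeProb ρ (P i))) := by
    rw [hA, entropy_sum]
    · exact Finset.sum_congr rfl fun i _ =>
        entropy_smul_proj (hP.isHermitian i) (hP.mul_self i) (hP.trace_eq_one i) _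
    · intro i
      rw [Matrix.IsHermitian, Matrix.conjTranspose_smul, (hP.isHermitian i).eq, Complex.star_def,
        Complex.conj_ofReal]
    · intro i j hij
      rw [smul_mul_smul_comm, hP.orthogonal i j hij, smul_zero]
  -- The block entropies cancel against `entropy ρ`, and the Shannon entropy of the outcomes against
  -- `entropy (trB ρ)`.
  rw [mutualI_sub_mutualJ, hP.condEntropy_eq hρ, hSA, hS, Finset.sum_add_distrib,
    Finset.sum_neg_distrib]
  ring

lemma continuous_onA : Continuous (onA B : Matrix A A ℂ → Matrix (A × B) (A × B) ℂ) :=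
  continuous_matrix fun x y => (continuous_id.matrix_elem x.1 y.1).mul continuous_const

lemma continuous_basisMeasurement (i : A) :
    Continuous fun V : Matrix A A ℂ => basisMeasurement V i := by
  unfold basisMeasurement
  fun_prop

/-- The minimum in the definition of the discord is attained. -/
lemma isLeast_discordBA {ρ : Matrix (A × B) (A × B) ℂ} (hρ : ρ.PosSemidef) :
    IsLeast (discordValues ρ) (discordBA ρ) := by
  -- `I - J` as a function of the measurement basis, with unnormalized blocks so that it stays
  -- continuous where an outcome has probability zero.
  let F : Matrix A A ℂ → ℝ := fun V => entropy (trB ρ) - entropy ρ +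
    ∑ i, (entropy (onA B (basisMeasurement V i) * ρ * onA B (basisMeasurement V i)) +
      outcomeProb ρ (basisMeasurement V i) * Real.logb 2 (outcomeProb ρ (basisMeasurement V i)))
  have hon : ∀ i, Continuous fun V : Matrix A A ℂ => onA B (basisMeasurement V i) := fun i =>
    continuous_onA.comp (continuous_basisMeasurement i)
  have hp : ∀ i, Continuous fun V : Matrix A A ℂ => outcomeProb ρ (basisMeasurement V i) := fun i => by
    have := hon i
    unfold outcomeProb
    fun_prop
  have hlog : Continuous fun x : ℝ => x * Real.logb 2 x := by
    have h : (fun x : ℝ => x * Real.logb 2 x) = fun x => x * Real.log x / Real.log 2 := by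
      ext x
      rw [Real.logb, mul_div_assoc]
    rw [h]
    exact Real.continuous_mul_log.div_const _
  have hF : Continuous F := by
    refine continuous_const.add (continuous_finsetSum _ fun i _ => ?_)
    refine Continuous.add (continuous_entropy ?_ fun V => ?_) (hlog.comp (hp i))
    · have := hon i
      fun_prop
    · have hherm : (basisMeasurement V i).IsHermitian := by
        ext a b
        simp [basisMeasurement_apply, mul_comm]
      have h := (hρ.mul_mul_conjTranspose_same (onA B (basisMeasurement V i))).isHermitian
      rwa [(isHermitian_onA hherm).eq] at h
  have hset : discordValues ρ = F '' (Matrix.unitaryGroup A ℂ : Set (Matrix A A ℂ)) := by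
    ext d
    constructor
    · rintro ⟨P, hP, rfl⟩
      obtain ⟨V, hV, rfl⟩ := hP.exists_unitary
      refine ⟨V, hV, ?_⟩
      rw [mutualI_sub_mutualJ, hP.condEntropy_eq hρ]
    · rintro ⟨V, hV, rfl⟩
      refine ⟨basisMeasurement V, isMeasurement_basisMeasurement hV, ?_⟩
      rw [mutualI_sub_mutualJ, (isMeasurement_basisMeasurement hV).condEntropy_eq hρ]
  have hcomp : IsCompact (discordValues ρ) := by
    rw [hset]
    exact isCompact_unitaryGroup.image hF
  have hne : (discordValues ρ).Nonempty := by
    rw [hset]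
    exact ⟨F 1, 1, one_mem _, rfl⟩
  exact hcomp.isLeast_sInf hne

/-- Attainment supplies a measurement with `I - J = 0`. The one that makes `ρ` block diagonal is
obtained from it and may be different. -/
lemma discordBA_eq_zero_iff {ρ : Matrix (A × B) (A × B) ℂ} (hρ : IsState ρ) :
    discordBA ρ = 0 ↔ ∃ P : A → Matrix A A ℂ, IsMeasurement P ∧
      ρ = ∑ i, onA B (P i) * ρ * onA B (P i) := by
  have hleast := isLeast_discordBA hρ.posSemidef
  constructor
  · intro h0
    obtain ⟨P, hP, hd⟩ := hleast.1
    exact (hP.mutualI_sub_mutualJ_nonneg hρ).2 (hd.symm.trans h0)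
  · rintro ⟨P, hP, h⟩
    refine hleast.unique ⟨⟨P, hP, (hP.mutualI_sub_mutualJ_eq_zero hρ.posSemidef h).symm⟩, ?_⟩
    rintro d ⟨P', hP', rfl⟩
    exact (hP'.mutualI_sub_mutualJ_nonneg hρ).1

lemma exists_isState [Nonempty B] : ∃ τ : Matrix B B ℂ, IsState τ := by
  obtain ⟨b⟩ := ‹Nonempty B›
  refine ⟨Matrix.diagonal (Pi.single b 1), Matrix.PosSemidef.diagonal ?_, ?_⟩
  · exact Pi.single_nonneg.2 zero_le_one
  · simp

lemma IsMeasurement.exists_cqMatrix {P : A → Matrix A A ℂ} (hP : IsMeasurement P)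
    {ρ : Matrix (A × B) (A × B) ℂ} (hρ : IsState ρ)
    (h : ρ = ∑ i, onA B (P i) * ρ * onA B (P i)) :
    ∃ (p : A → ℝ) (τ : A → Matrix B B ℂ), (∀ j, 0 ≤ p j) ∧ ∑ j, p j = 1 ∧
      (∀ j, IsState (τ j)) ∧ ρ = cqMatrix p P τ := by
  classical
  have : Nonempty B := by
    by_contra hB
    rw [not_nonempty_iff] at hB
    have := hρ.trace_eq_one
    simp [Matrix.trace] at this
  obtain ⟨τ₀, hτ₀⟩ := exists_isState (B := B)
  obtain ⟨σ, hσ⟩ := hP.exists_block hρ.posSemidef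
  have hp0 : ∀ i, 0 ≤ outcomeProb ρ (P i) := fun i => by
    have h := (hσ i).1.trace_nonneg
    rw [(hσ i).2.2] at h
    exact_mod_cast h
  have hτ : ∀ i, ∃ τ : Matrix B B ℂ, IsState τ ∧ σ i = (outcomeProb ρ (P i) : ℂ) • τ := by
    intro i
    rcases eq_or_ne (outcomeProb ρ (P i)) 0 with h0 | h0
    · refine ⟨τ₀, hτ₀, ?_⟩
      rw [h0, Complex.ofReal_zero, zero_smul]
      exact (hσ i).1.trace_eq_zero_iff.1 (by rw [(hσ i).2.2, h0, Complex.ofReal_zero])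
    · have h0' : (outcomeProb ρ (P i) : ℂ) ≠ 0 := by exact_mod_cast h0
      refine ⟨((outcomeProb ρ (P i))⁻¹ : ℂ) • σ i, ⟨?_, ?_⟩, ?_⟩
      · rw [← Complex.ofReal_inv]
        exact (hσ i).1.smul (by exact_mod_cast inv_nonneg.2 (hp0 i))
      · rw [Matrix.trace_smul, (hσ i).2.2, smul_eq_mul, inv_mul_cancel₀ h0']
      · rw [smul_smul, mul_inv_cancel₀ h0', one_smul]
  choose τ hτ1 hτ2 using hτ
  refine ⟨fun i => outcomeProb ρ (P i), τ, hp0, ?_, hτ1, ?_⟩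
  · rw [hP.toIsProjFamily.sum_outcomeProb, hρ.trace_eq_one, Complex.one_re]
  · conv_lhs => rw [h]
    refine Finset.sum_congr rfl fun i _ => ?_
    rw [(hσ i).2.1, hτ2, Matrix.kronecker_smul]

/-- Refines projectors of arbitrary rank to rank one: the case `H = 1` of
`IsProjFamily.exists_measurement`, with the weights absorbed into `τ`. -/
lemma IsProjFamily.exists_measurement_cqMatrix {P : ι → Matrix A A ℂ} (hP : IsProjFamily P)
    (p : ι → ℝ) (τ : ι → Matrix B B ℂ) :
    ∃ P' : A → Matrix A A ℂ, IsMeasurement P' ∧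
      cqMatrix p P τ = ∑ i, QDiscord.onA B (P' i) * cqMatrix p P τ * QDiscord.onA B (P' i) := by
  have h := hP.exists_measurement (H := 1) (τ := fun i => (p i : ℂ) • τ i) Matrix.isHermitian_one
    (by rw [onA_one]; exact Commute.one_left _)
  have hcq : QDiscord.onA B (1 : Matrix A A ℂ) * ∑ i, P i ⊗ₖ ((p i : ℂ) • τ i) =
      cqMatrix p P τ := by
    rw [onA_one, one_mul, cqMatrix]
    exact Finset.sum_congr rfl fun i _ => Matrix.kronecker_smul _ _ _
  rwa [hcq] at h

end Discord

end QDiscord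

open QDiscord in
/-- Zero discord (with measurements on the system `A`), its equivalent forms, and complete
positivity of the reduced evolution of every state of zero discord. The first part says that the
minimum defining the discord is attained. In the last part the operators do not depend on the
weights `p`, so that one and the same CPTP map describes the evolution of all the states with the
same projectors and the same `τ`. -/
theorem mainTheorem1 {A B : Type*} [Fintype A] [DecidableEq A] [Fintype B] [DecidableEq B]
    (ρ : Matrix (A × B) (A × B) ℂ) (hρ : IsState ρ) :
    IsLeast (discordValues ρ) (discordBA ρ) ∧
    List.TFAE [
      discordBA ρ = 0,
      ∃ P : A → Matrix A A ℂ, IsMeasurement P ∧ ρ = ∑ i, onA B (P i) * ρ * onA B (P i),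
      ∃ (P : A → Matrix A A ℂ) (p : A → ℝ) (τ : A → Matrix B B ℂ),
        IsMeasurement P ∧ (∀ j, 0 ≤ p j) ∧ ∑ j, p j = 1 ∧ (∀ j, IsState (τ j)) ∧
          ρ = cqMatrix p P τ,
      ∃ (k : ℕ) (P : Fin k → Matrix A A ℂ) (p : Fin k → ℝ) (τ : Fin k → Matrix B B ℂ),
        IsProjFamily P ∧ (∀ j, 0 ≤ p j) ∧ (∀ j, IsState (τ j)) ∧ ρ = cqMatrix p P τ] ∧
    ∀ (ι : Type*) [Fintype ι] (P : ι → Matrix A A ℂ) (p : ι → ℝ) (τ : ι → Matrix B B ℂ),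
      IsProjFamily P → (∀ j, 0 ≤ p j) → (∀ j, IsState (τ j)) → ρ = cqMatrix p P τ →
      ∀ U ∈ Matrix.unitaryGroup (A × B) ℂ,
      ∀ e : OrthonormalBasis B ℂ (EuclideanSpace ℂ B),
        (∑ α, (krausOp P τ U e α)ᴴ * krausOp P τ U e α = 1) ∧
        IsCPTP (krausMap (krausOp P τ U e)) ∧
        reducedEvolution U ρ =
          ∑ α, krausOp P τ U e α * trB ρ * (krausOp P τ U e α)ᴴ ∧
        ∀ q : ι → ℝ, IsState (cqMatrix q P τ) →
          reducedEvolution U (cqMatrix q P τ) =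
            krausMap (krausOp P τ U e) (trB (cqMatrix q P τ)) := by
  refine ⟨isLeast_discordBA hρ.posSemidef, ?_, ?_⟩
  · tfae_have 1 ↔ 2 := discordBA_eq_zero_iff hρ
    tfae_have 2 → 3 := by
      rintro ⟨P, hP, h⟩
      obtain ⟨p, τ, h1, h2, h3, h4⟩ := hP.exists_cqMatrix hρ h
      exact ⟨P, p, τ, hP, h1, h2, h3, h4⟩
    tfae_have 3 → 4 := by
      rintro ⟨P, p, τ, hP, hp, -, hτ, h⟩
      let E := (Fintype.equivFin A).symm
      refine ⟨Fintype.card A, P ∘ E, p ∘ E, τ ∘ E, ⟨fun i => hP.isHermitian _,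
        fun i => hP.mul_self _, fun i j hij => hP.orthogonal _ _ (E.injective.ne hij), ?_⟩,
        fun j => hp _, fun j => hτ _, ?_⟩
      · rw [← hP.complete]
        exact E.sum_comp P
      · rw [h]
        exact (E.sum_comp fun j => (p j : ℂ) • (P j ⊗ₖ τ j)).symm
    tfae_have 4 → 2 := by
      rintro ⟨k, P, p, τ, hP, -, -, h⟩
      rw [h]
      exact hP.exists_measurement_cqMatrix p τ
    tfae_finish
  · intro ι _ P p τ hP _ hτ h U hU e
    have hK := sum_krausOp_conjTranspose_mul hP hτ hU e
    refine ⟨hK, isCPTP_krausMap hK, ?_, fun q _ => reducedEvolution_cqMatrix hP hτ U e q⟩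
    rw [h]
    exact reducedEvolution_cqMatrix hP hτ U e p
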